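/- **Model.** In the Massive Parallel Computation (MPC) model there are $p\ge 1$ machines, each with a memory of $s$ words, a word having $O(\log n)$ bits. The input is a graph $G$ on the vertex set $[n]$ with $m$ edges; the edges (two words each) are initially distributed among the machines, every edge being stored on exactly one machine. Computation proceeds in synchronous rounds: in each round every machine flips private fair coins, performs an arbitrary local computation on its memory contents and these coins (the parameters $n$, $m$, $p$, $s$, the round number and its own identity are known to it), and sends messages to other machines, which are received before the next round. At all times the contents of the memory of a machine, including the messages it has just received, must fit into $s$ words; so must, in each round, what it keeps together with all messages it sends; and so must its part of the output. An execution that violates this counts as failed. After the last round each machine outputs a set of vertices; the result is the union of these sets. The total memory is linear in the input size, i.e. $p\cdot s=O(n+m)$. **Theorem 1.** There is a randomized MPC algorithm with $s=O(n)$ words of memory per machine and $p\cdot s=O(n+m)$ that, in $O(\log\log n)$ rounds and with high probability, computes an $O(\log n)$-approximation to minimum vertex cover. Precisely: for every constant $K\in\mathbb N$ there are a constant $C$ and, for all $n,m$, an algorithm in the above model such that for all $n\ge 3$ and all $m$ we have $s\le C n$, $p\cdot s\le C(n+m)$, words of at most $C\log n$ bits, and at most $C\log\log n$ rounds; and for every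 graph $G$ on $[n]$ with $m$ edges and every initial distribution of its edges in which each machine holds at most $K\,(\lfloor m/p\rfloor+1)$ edges, with probability at least $1-C/n$ over the coins the execution respects the memory bounds and the output is a vertex cover of $G$ of size at most $C\log n\cdot \mathsf{opt}(G)$, where $\mathsf{opt}(G)$ is the minimum size of a vertex cover of $G$. -/

import Mathlib

/-! The model of Massive Parallel Computation (MPC) and approximate vertex covers. -/

namespace MPC

/-- What a machine stores at the beginning of a round: the words `mem` it has kept, and, for every
machine `j`, the words `inbox j` that it has just received from machine `j`. -/
structure LocalState (p : ℕ) where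
  mem : List ℕ
  inbox : Fin p → List ℕ

/-- Number of words stored. -/
def LocalState.size {p : ℕ} (σ : LocalState p) : ℕ :=
  σ.mem.length + ∑ j, (σ.inbox j).length

/-- Every stored word is a word of `b` bits. -/
def LocalState.WordsBelow {p : ℕ} (σ : LocalState p) (b : ℕ) : Prop :=
  (∀ x ∈ σ.mem, x < 2 ^ b) ∧ ∀ j, ∀ x ∈ σ.inbox j, x < 2 ^ b

/-- A randomized MPC algorithm for graphs on the vertex set `Fin n`, for fixed problem parameters:
the resources, and the code of each machine. In each round a machine flips `coins` fair private
coins and computes, from its local state and these coins, the words to be kept and the words to be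
sent to each machine. Local computation is free, as usual in this model. After the last round each
machine outputs a set of vertices. -/
structure Algorithm (n : ℕ) where
  /-- number of machines -/
  machines : ℕ
  machines_pos : 0 < machines
  /-- memory of each machine, in words -/
  memory : ℕ
  /-- number of bits of a word -/
  wordBits : ℕ
  /-- number of rounds -/
  rounds : ℕ
  /-- number of coins flipped by each machine in each round -/
  coins : ℕ
  /-- local computation: round, machine, coins, local state ↦ words kept, words sent -/
  step : Fin rounds → Fin machines → (Fin coins → Bool) → LocalState machines →
    List ℕ × (Fin machines → List ℕ)
  /-- vertices output by each machine -/
  output : Fin machines → LocalState machines → Finset (Fin n)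

namespace Algorithm

variable {n : ℕ} (A : Algorithm n)

/-- The outcomes of all coins: one block of coins for every round and every machine. -/
abbrev Coins : Type := Fin A.rounds → Fin A.machines → Fin A.coins → Bool

/-- An initial placement of edges (ordered pairs of endpoints, in a list) on the machines. -/
abbrev Placement : Type := Fin A.machines → List (Fin n × Fin n)

/-- The local states before the first round: each machine stores the endpoints of its edges,
two words per edge. -/
def start (E : A.Placement) (i : Fin A.machines) : LocalState A.machines where
  mem := (E i).flatMap fun e => [(e.1 : ℕ), (e.2 : ℕ)]
  inbox := fun _ => []

/-- The local states after `t` rounds (constant from `t = A.rounds` on). -/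
def states (E : A.Placement) (ω : A.Coins) : ℕ → Fin A.machines → LocalState A.machines
  | 0 => A.start E
  | t + 1 => fun i =>
    if h : t < A.rounds then
      { mem := (A.step ⟨t, h⟩ i (ω ⟨t, h⟩ i) (states E ω t i)).1
        inbox := fun j => (A.step ⟨t, h⟩ j (ω ⟨t, h⟩ j) (states E ω t j)).2 i }
    else states E ω t i

/-- The result of the local computation of machine `i` in round `t`. -/
def action (E : A.Placement) (ω : A.Coins) (t : Fin A.rounds) (i : Fin A.machines) :
    List ℕ × (Fin A.machines → List ℕ) :=
  A.step t i (ω t i) (A.states E ω t i)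

/-- The set output collectively by the machines. -/
def result (E : A.Placement) (ω : A.Coins) : Finset (Fin n) :=
  Finset.univ.biUnion fun i => A.output i (A.states E ω A.rounds i)

/-- The execution respects the memory of the machines: at all times everything that a machine
stores (including the messages just received) consists of words of the prescribed length and fits
into its memory; in every round what it keeps together with what it sends fits into its memory;
and so does its output. -/
def WithinMemory (E : A.Placement) (ω : A.Coins) : Prop :=
  (∀ t ≤ A.rounds, ∀ i, (A.states E ω t i).size ≤ A.memory ∧
    (A.states E ω t i).WordsBelow A.wordBits) ∧
  (∀ t i, (A.action E ω t i).1.length + ∑ j, ((A.action E ω t i).2 j).length ≤ A.memory) ∧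
  ∀ i, (A.output i (A.states E ω A.rounds i)).card ≤ A.memory

open Classical in
/-- Probability of an event when all coins are fair and independent. -/
noncomputable def prob (S : A.Coins → Prop) : ℝ :=
  ((Finset.univ.filter S).card : ℝ) / (Fintype.card A.Coins : ℝ)

/-- `E` distributes the edges of `G` over the machines: each edge of `G` is stored exactly once. -/
def Distributes (E : A.Placement) (G : SimpleGraph (Fin n)) [DecidableRel G.Adj] : Prop :=
  ∑ i, ((E i : Multiset (Fin n × Fin n)).map fun e => s(e.1, e.2)) = G.edgeFinset.val

end Algorithm

/-- `S` is a vertex cover of `G` of size at most `α` times the minimum size of a vertex cover.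
(The vertex cover number is finite here.) -/
def IsApproxVertexCover {n : ℕ} (G : SimpleGraph (Fin n)) (α : ℝ) (S : Finset (Fin n)) : Prop :=
  G.IsVertexCover (S : Set (Fin n)) ∧ (S.card : ℝ) ≤ α * (G.vertexCoverNum.toNat : ℝ)

end MPC

/-! Peel the graph: remove all vertices of degree at least a threshold, halve the threshold, and
repeat about log n times. If `O` is an optimal cover, double counting edges into `O` shows that each
threshold costs only O(|O|) vertices outside `O`. To save rounds, a phase handles many thresholds at
once. Vertices get random labels among `2 ^ a` classes, the edges inside a class are gathered on one
machine, and that machine peels by local degrees, with thresholds divided by `2 ^ a`.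

The obstacle is that after one local step the surviving set depends on the labels, so concentration
no longer applies to it. The analysis therefore compares with `layers`, a peeling defined from `O`
and the current graph alone, hence fixed before the labels are drawn. Its thresholds for `O` and for
the complement differ by a constant factor that absorbs the sampling error. By induction
(`peel_sandwich`) the real peeling removes every vertex of `O` that the reference removes and no
vertex outside `O` that the reference keeps. `card_compl_sdiff_layers_le` bounds what the reference
drops; `card_phase_sdiff_le` adds the vertices of large true degree, which are removed at the end of
a phase.

Sampling is reliable while local degrees are at least of order log n (`slack`), and a class fits on
a machine if `2 ^ a` is about m/n in the first phase and about the square root of the degree bound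
later. The exponent of the degree bound is then roughly halved in each phase until it is of order
log log n, and afterwards drops by at least one per phase, so O(log log n) phases leave no edge
(`degBits_phases`). Fresh labels make each phase good with high probability given the past
(`frac_not_goodLabels_drawn_le`). The section on the simulation identifies the message-passing
execution with this abstract process (`updatedMem_run`). -/

namespace MPC

/-! ### Uniform probability on finite types. -/

section Averages

open Finset Classical

variable {α β γ ι κ : Type*} [Fintype α] [Fintype β] [Fintype ι] [Fintype κ]
  [DecidableEq ι] [DecidableEq κ]

/-- Average of a function over a finite type. -/
noncomputable def avg (f : α → ℝ) : ℝ := (∑ x, f x) / (Fintype.card α : ℝ)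

/-- Fraction of the elements of a finite type that satisfy a predicate. -/
noncomputable def frac (P : α → Prop) : ℝ :=
  ((univ.filter P).card : ℝ) / (Fintype.card α : ℝ)

theorem frac_eq_avg (P : α → Prop) [DecidablePred P] :
    frac P = avg fun x => if P x then (1 : ℝ) else 0 := by
  rw [frac, avg, sum_boole]
  congr!

theorem avg_mono {f g : α → ℝ} (h : ∀ x, f x ≤ g x) : avg f ≤ avg g := by
  unfold avg
  gcongr with x _
  exact h x

theorem avg_const [Nonempty α] (c : ℝ) : avg (fun _ : α => c) = c := by
  have : (Fintype.card α : ℝ) ≠ 0 := by exact_mod_cast Fintype.card_ne_zero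
  simp [avg, this]

theorem avg_const_le {c : ℝ} (hc : 0 ≤ c) : avg (fun _ : α => c) ≤ c := by
  rcases isEmpty_or_nonempty α with h | h
  · simpa [avg] using hc
  · exact (avg_const c).le

theorem avg_add (f g : α → ℝ) : avg (fun x => f x + g x) = avg f + avg g := by
  simp [avg, sum_add_distrib, add_div]

theorem avg_sum (s : Finset γ) (f : γ → α → ℝ) :
    avg (fun x => ∑ i ∈ s, f i x) = ∑ i ∈ s, avg (f i) := by
  simp only [avg]
  rw [sum_comm, sum_div]

theorem avg_const_mul (c : ℝ) (f : α → ℝ) : avg (fun x => c * f x) = c * avg f := by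
  simp [avg, ← mul_sum, mul_div_assoc]

theorem avg_mul_const (c : ℝ) (f : α → ℝ) : avg (fun x => f x * c) = avg f * c := by
  simp [avg, ← sum_mul, div_mul_eq_mul_div]

theorem frac_mono {P Q : α → Prop} (h : ∀ x, P x → Q x) : frac P ≤ frac Q := by
  unfold frac
  gcongr with x _
  exact h x

theorem frac_or_le (P Q : α → Prop) : frac (fun x => P x ∨ Q x) ≤ frac P + frac Q := by
  rw [frac_eq_avg, frac_eq_avg, frac_eq_avg, ← avg_add]
  refine avg_mono fun x => ?_
  by_cases h1 : P x <;> by_cases h2 : Q x <;> simp [h1, h2]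

theorem frac_exists_le (s : Finset γ) (P : γ → α → Prop) {ε : ℝ}
    (h : ∀ i ∈ s, frac (P i) ≤ ε) : frac (fun x => ∃ i ∈ s, P i x) ≤ s.card * ε := by
  calc frac (fun x => ∃ i ∈ s, P i x)
      ≤ ∑ i ∈ s, frac (P i) := by
        simp only [frac_eq_avg, ← avg_sum]
        refine avg_mono fun x => ?_
        split_ifs with hx
        · obtain ⟨i, hi, hix⟩ := hx
          have := single_le_sum (f := fun i => if P i x then (1 : ℝ) else 0)
            (fun j _ => by positivity) hi
          simpa [hix] using this
        · exact sum_nonneg fun j _ => by positivity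
    _ ≤ ∑ i ∈ s, ε := sum_le_sum h
    _ = s.card * ε := by simp

theorem one_sub_frac_not_le [Nonempty α] (P : α → Prop) : 1 - frac (fun x => ¬ P x) ≤ frac P := by
  have h := frac_or_le P (fun x => ¬ P x)
  have h1 : frac (fun x : α => P x ∨ ¬ P x) = 1 := by
    have h2 : (fun x : α => P x ∨ ¬ P x) = fun _ => True := by
      funext x; exact propext ⟨fun _ => trivial, fun _ => Classical.em _⟩
    rw [h2, frac_eq_avg]
    simpa using avg_const (α := α) 1
  linarith

theorem frac_le_of_markov {P : α → Prop} {f : α → ℝ} {c : ℝ} (hf : ∀ x, 0 ≤ f x)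
    (hP : ∀ x, P x → c ≤ f x) : frac P * c ≤ avg f := by
  rw [frac_eq_avg, ← avg_mul_const]
  refine avg_mono fun x => ?_
  split_ifs with h
  · simpa using hP x h
  · simpa using hf x

/-- Exchanging coordinate `t` of `ω` with the fresh value `c` is an involution on pairs. This takes
the place of conditioning on all other coordinates. -/
theorem avg_resample (F : (ι → β) → ℝ) (t : ι) :
    avg F = avg fun ω => avg fun c => F (Function.update ω t c) := by
  rcases isEmpty_or_nonempty β with hβ | hβ
  · have : IsEmpty (ι → β) := ⟨fun ω => hβ.elim (ω t)⟩
    simp [avg]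
  have hb : (Fintype.card β : ℝ) ≠ 0 := by exact_mod_cast Fintype.card_ne_zero
  let e : (ι → β) × β ≃ (ι → β) × β :=
    { toFun := fun q => (Function.update q.1 t q.2, q.1 t)
      invFun := fun q => (Function.update q.1 t q.2, q.1 t)
      left_inv := fun q => by simp
      right_inv := fun q => by simp }
  have h : ∑ ω : ι → β, ∑ c : β, F (Function.update ω t c) = Fintype.card β * ∑ ω, F ω := by
    rw [← Fintype.sum_prod_type' (f := fun (ω : ι → β) c => F (Function.update ω t c))]
    refine (Equiv.sum_comp e (fun q : (ι → β) × β => F q.1)).trans ?_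
    rw [Fintype.sum_prod_type]
    simp [mul_sum]
  simp only [avg, ← sum_div, h]
  field_simp

theorem frac_le_of_resample (P : (ι → β) → Prop) (t : ι) {ε : ℝ} (hε : 0 ≤ ε)
    (h : ∀ ω, frac (fun c => P (Function.update ω t c)) ≤ ε) : frac P ≤ ε := by
  rw [frac_eq_avg, avg_resample _ t]
  refine (avg_mono fun ω => ?_).trans (avg_const_le hε)
  rw [← frac_eq_avg]
  exact h ω

theorem frac_equiv (e : α ≃ β) (P : β → Prop) : frac (fun x => P (e x)) = frac P := by
  simp only [frac_eq_avg, avg]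
  rw [Fintype.card_congr e, Equiv.sum_comp e (fun y => if P y then (1 : ℝ) else 0)]

theorem frac_prod_fst [Nonempty β] (P : α → Prop) : frac (fun x : α × β => P x.1) = frac P := by
  have hb : (Fintype.card β : ℝ) ≠ 0 := by exact_mod_cast Fintype.card_ne_zero
  have h : ∑ x : α × β, (if P x.1 then (1 : ℝ) else 0)
      = Fintype.card β * ∑ x, if P x then (1 : ℝ) else 0 := by
    rw [Fintype.sum_prod_type, mul_sum]
    refine sum_congr rfl fun x _ => ?_
    split_ifs <;> simp
  rw [frac_eq_avg, frac_eq_avg, avg, avg, h, Fintype.card_prod, Nat.cast_mul,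
    mul_comm (Fintype.card α : ℝ), mul_div_mul_left _ _ hb]

/-- The marginal of the uniform distribution on a subset of the coordinates is uniform. -/
theorem frac_comp_injective [Nonempty β] (e : κ → ι) (he : Function.Injective e)
    (P : (κ → β) → Prop) : frac (fun ω : ι → β => P fun x => ω (e x)) = frac P := by
  -- Split the coordinates into the range of `e` and the rest; the rest is a product factor that
  -- averages out.
  let E1 := Equiv.piEquivPiSubtypeProd (fun i => i ∈ Set.range e) (fun _ : ι => β)
  let E2 : (κ → β) ≃ ({i // i ∈ Set.range e} → β) :=
    Equiv.arrowCongr (Equiv.ofInjective e he) (Equiv.refl β)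
  have h1 : (fun ω : ι → β => P fun x => ω (e x)) = fun ω => P (E2.symm (E1 ω).1) := by
    funext ω
    rfl
  rw [h1, frac_equiv E1 (fun q => P (E2.symm q.1)), frac_prod_fst (fun q => P (E2.symm q)),
    frac_equiv E2.symm]

end Averages

/-! ### Concentration of random vertex labels. -/

section Labels

open Finset Classical

variable {V Λ : Type*} [Fintype V] [DecidableEq V] [Fintype Λ]

/-- Independence of the labels of different vertices. -/
theorem avg_prod (h : V → Λ → ℝ) :
    avg (fun f : V → Λ => ∏ v, h v (f v)) = ∏ v, avg (h v) := by
  simp only [avg]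
  rw [← Fintype.prod_sum, prod_div_distrib]
  simp

/-- Number of vertices of `S` with label `c`. -/
def labelCount (g : V → ℕ) (S : Finset V) (c : ℕ) : ℕ := (S.filter fun u => g u = c).card

/-- The values of `lab` are uniformly distributed among the numbers below `k`. -/
def IsUniformLabel (lab : Λ → ℕ) (k : ℕ) : Prop :=
  ∀ c < k, frac (fun x => lab x = c) = 1 / (k : ℝ)

/-- Every label class below `k` contains roughly its share of `S`, as far as sizes of at least
`θ` are concerned. -/
def Balanced (k θ : ℕ) (g : V → ℕ) (S : Finset V) : Prop :=
  ∀ c < k, ∀ T, θ ≤ T → (2 * S.card ≤ k * T → labelCount g S c < T) ∧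
    (2 * k * T ≤ S.card → T ≤ labelCount g S c)

variable {lab : Λ → ℕ} {k : ℕ}

/-- The moment generating function of a binomial variable, used with base 2 for the upper tail and
1/2 for the lower one. -/
theorem avg_pow_labelCount_le [Nonempty Λ] (hlab : IsUniformLabel lab k) (S : Finset V) {c : ℕ}
    (hc : c < k) {b : ℝ} (hb : 0 ≤ b) :
    avg (fun f : V → Λ => b ^ labelCount (fun v => lab (f v)) S c)
      ≤ Real.exp ((b - 1) * (S.card / k)) := by
  have hk : (1 : ℝ) ≤ k := by exact_mod_cast (by omega : 1 ≤ k)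
  have h1 : ∀ f : V → Λ, b ^ labelCount (fun v => lab (f v)) S c
      = ∏ v, (if v ∈ S then (if lab (f v) = c then b else 1) else 1) := by
    intro f
    rw [labelCount, prod_ite_mem, univ_inter, prod_ite]
    simp
  have h2 : ∀ v, avg (fun x => if v ∈ S then (if lab x = c then b else 1) else 1)
      = if v ∈ S then 1 + (b - 1) / k else 1 := by
    intro v
    split_ifs with hv
    · have : (fun x : Λ => if lab x = c then b else 1)
          = fun x => 1 + (b - 1) * (if lab x = c then (1 : ℝ) else 0) := by
        funext x; split_ifs <;> ring
      rw [this, avg_add, avg_const, avg_const_mul, ← frac_eq_avg, hlab c hc]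
      ring
    · exact avg_const 1
  simp only [h1]
  rw [avg_prod (fun v x => if v ∈ S then (if lab x = c then b else 1) else 1)]
  simp only [h2]
  rw [prod_ite_mem, univ_inter, prod_const]
  have h3 : 0 ≤ 1 + (b - 1) / k := by
    have : -1 ≤ (b - 1) / k := by
      rw [le_div_iff₀ (by linarith)]
      linarith
    linarith
  calc (1 + (b - 1) / k) ^ S.card ≤ Real.exp ((b - 1) / k) ^ S.card := by
        gcongr
        linarith [Real.add_one_le_exp ((b - 1) / k)]
    _ = _ := by
        rw [← Real.exp_nat_mul]
        congr 1
        ring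

/-- Chernoff: the mean is at most T/2, so Markov for 2^count gives (√e / 2)^T, and √e ≤ 5/3. -/
theorem frac_labelCount_ge_le [Nonempty Λ] (hlab : IsUniformLabel lab k) (S : Finset V) {c T : ℕ}
    (hc : c < k) (hT : 2 * S.card ≤ k * T) :
    frac (fun f : V → Λ => T ≤ labelCount (fun v => lab (f v)) S c) ≤ (5 / 6 : ℝ) ^ T := by
  have hk : (0 : ℝ) < k := by exact_mod_cast (by omega : 0 < k)
  have h1 := avg_pow_labelCount_le (V := V) hlab S hc (b := 2) (by norm_num)
  have h2 := frac_le_of_markov (P := fun f : V → Λ => T ≤ labelCount (fun v => lab (f v)) S c)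
    (f := fun f : V → Λ => (2 : ℝ) ^ labelCount (fun v => lab (f v)) S c) (c := 2 ^ T)
    (fun _ => by positivity) (fun f hf => pow_le_pow_right₀ (by norm_num) hf)
  have h3 : Real.exp ((2 - 1) * (S.card / k)) ≤ (5 / 3 : ℝ) ^ T := by
    calc Real.exp ((2 - 1) * (S.card / k)) ≤ Real.exp (T * (1 / 2)) := by
          apply Real.exp_le_exp.2
          have : (2 * S.card : ℝ) ≤ k * T := by exact_mod_cast hT
          rw [one_div, ← div_eq_mul_inv, show ((2 : ℝ) - 1) = 1 by norm_num, one_mul,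
            div_le_div_iff₀ hk (by norm_num)]
          linarith
      _ = Real.exp (1 / 2) ^ T := Real.exp_nat_mul _ _
      _ ≤ _ := by
          gcongr
          rw [← abs_of_pos (Real.exp_pos (1 / 2)), ← abs_of_pos (by norm_num : (0 : ℝ) < 5 / 3),
            ← sq_le_sq, ← Real.exp_nat_mul]
          have := Real.exp_one_lt_d9
          norm_num at this ⊢
          linarith
  have h4 : (5 / 6 : ℝ) ^ T * 2 ^ T = (5 / 3) ^ T := by rw [← mul_pow]; norm_num
  have h5 : (0 : ℝ) < 2 ^ T := by positivity
  refine le_of_mul_le_mul_right ?_ h5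
  rw [h4]
  linarith

/-- Chernoff: the mean is at least 2T, so Markov for (1/2)^count gives (2/e)^T, and 1/e ≤ 5/12. -/
theorem frac_labelCount_lt_le [Nonempty Λ] (hlab : IsUniformLabel lab k) (S : Finset V) {c T : ℕ}
    (hc : c < k) (hT : 2 * k * T ≤ S.card) :
    frac (fun f : V → Λ => labelCount (fun v => lab (f v)) S c < T) ≤ (5 / 6 : ℝ) ^ T := by
  have hk : (0 : ℝ) < k := by exact_mod_cast (by omega : 0 < k)
  have h1 := avg_pow_labelCount_le (V := V) hlab S hc (b := 1 / 2) (by norm_num)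
  have h2 := frac_le_of_markov (P := fun f : V → Λ => labelCount (fun v => lab (f v)) S c < T)
    (f := fun f : V → Λ => (1 / 2 : ℝ) ^ labelCount (fun v => lab (f v)) S c) (c := (1 / 2) ^ T)
    (fun _ => by positivity)
    (fun f hf => pow_le_pow_of_le_one (by norm_num) (by norm_num) hf.le)
  have h3 : Real.exp ((1 / 2 - 1) * (S.card / k)) ≤ (5 / 12 : ℝ) ^ T := by
    calc Real.exp ((1 / 2 - 1) * (S.card / k)) ≤ Real.exp (T * (-1)) := by
          apply Real.exp_le_exp.2
          have : (2 * k * T : ℝ) ≤ S.card := by exact_mod_cast hT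
          have h : 2 * (T : ℝ) ≤ S.card / k := by
            rw [le_div_iff₀ hk]
            linarith
          linarith
      _ = Real.exp (-1) ^ T := Real.exp_nat_mul _ _
      _ ≤ _ := by
          gcongr
          rw [Real.exp_neg, inv_le_comm₀ (Real.exp_pos 1) (by norm_num)]
          have := Real.exp_one_gt_d9
          norm_num at this ⊢
          linarith
  have h4 : (5 / 6 : ℝ) ^ T * (1 / 2) ^ T = (5 / 12) ^ T := by rw [← mul_pow]; norm_num
  have h5 : (0 : ℝ) < (1 / 2) ^ T := by positivity
  refine le_of_mul_le_mul_right ?_ h5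
  rw [h4]
  linarith

/-- Thresholds `T` above the number of vertices cannot be violated, so a finite union bound over `c`
and `T` suffices. -/
theorem frac_not_balanced_le [Nonempty Λ] (hlab : IsUniformLabel lab k) (S : Finset V)
    (θ : ℕ) :
    frac (fun f : V → Λ => ¬ Balanced k θ (fun v => lab (f v)) S)
      ≤ k * ((Fintype.card V + 1 : ℕ) * (2 * (5 / 6 : ℝ) ^ θ)) := by
  have hS : S.card ≤ Fintype.card V := card_le_univ S
  have hpow : ∀ T, θ ≤ T → (5 / 6 : ℝ) ^ T ≤ (5 / 6) ^ θ :=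
    fun T hT => pow_le_pow_of_le_one (by norm_num) (by norm_num) hT
  have key : ∀ f : V → Λ, ¬ Balanced k θ (fun v => lab (f v)) S →
      ∃ c ∈ range k, ∃ T ∈ range (Fintype.card V + 1),
        (θ ≤ T ∧ 2 * S.card ≤ k * T ∧ T ≤ labelCount (fun v => lab (f v)) S c) ∨
        (θ ≤ T ∧ 2 * k * T ≤ S.card ∧ labelCount (fun v => lab (f v)) S c < T) := by
    intro f hf
    unfold Balanced at hf
    push Not at hf
    obtain ⟨c, hc, T, hT, h⟩ := hf
    have hcnt : labelCount (fun v => lab (f v)) S c ≤ S.card := card_filter_le _ _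
    by_cases h1 : 2 * S.card ≤ k * T ∧ T ≤ labelCount (fun v => lab (f v)) S c
    · exact ⟨c, mem_range.2 hc, T, mem_range.2 (by omega), Or.inl ⟨hT, h1⟩⟩
    · have h2 := h (fun h3 => by by_contra h4; exact h1 ⟨h3, by omega⟩)
      refine ⟨c, mem_range.2 hc, T, mem_range.2 ?_, Or.inr ⟨hT, h2⟩⟩
      have : 1 * T ≤ 2 * k * T := Nat.mul_le_mul_right _ (by omega)
      omega
  refine (frac_mono key).trans ?_
  have := frac_exists_le (α := V → Λ) (range k) (fun c f => ∃ T ∈ range (Fintype.card V + 1),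
        (θ ≤ T ∧ 2 * S.card ≤ k * T ∧ T ≤ labelCount (fun v => lab (f v)) S c) ∨
        (θ ≤ T ∧ 2 * k * T ≤ S.card ∧ labelCount (fun v => lab (f v)) S c < T))
      (ε := (Fintype.card V + 1 : ℕ) * (2 * (5 / 6 : ℝ) ^ θ)) ?_
  · simpa using this
  intro c hc
  have hc := mem_range.1 hc
  have := frac_exists_le (α := V → Λ) (range (Fintype.card V + 1)) (fun T f =>
        (θ ≤ T ∧ 2 * S.card ≤ k * T ∧ T ≤ labelCount (fun v => lab (f v)) S c) ∨
        (θ ≤ T ∧ 2 * k * T ≤ S.card ∧ labelCount (fun v => lab (f v)) S c < T))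
      (ε := 2 * (5 / 6 : ℝ) ^ θ) ?_
  · simpa using this
  intro T _
  refine (frac_or_le _ _).trans ?_
  have hfalse : frac (fun _ : V → Λ => False) ≤ (5 / 6 : ℝ) ^ θ := by
    simp only [frac_eq_avg, avg, if_false, sum_const_zero, zero_div]
    positivity
  rw [two_mul ((5 / 6 : ℝ) ^ θ)]
  refine add_le_add ?_ ?_
  · by_cases h : θ ≤ T ∧ 2 * S.card ≤ k * T
    · refine (frac_mono fun f hf => hf.2.2).trans
        ((frac_labelCount_ge_le hlab S hc h.2).trans (hpow T h.1))
    · exact (frac_mono fun f hf => h ⟨hf.1, hf.2.1⟩).trans hfalse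
  · by_cases h : θ ≤ T ∧ 2 * k * T ≤ S.card
    · refine (frac_mono fun f hf => hf.2.2).trans
        ((frac_labelCount_lt_le hlab S hc h.2).trans (hpow T h.1))
    · exact (frac_mono fun f hf => h ⟨hf.1, hf.2.1⟩).trans hfalse

/-- The labels of both endpoints agree. -/
def Monochromatic (g : V → ℕ) (e : Sym2 V) : Prop := (e.map g).IsDiag

/-- Only the label of `u` is redrawn: it hits the frozen label of `v` with probability 1/k, and `F`
does not notice. -/
theorem avg_mul_label_eq [Nonempty Λ] (hlab : IsUniformLabel lab k) (hlt : ∀ x, lab x < k)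
    {u v : V} (huv : u ≠ v) (F : (V → Λ) → ℝ) (hF : ∀ f c, F (Function.update f u c) = F f) :
    avg (fun f => F f * if lab (f u) = lab (f v) then (1 : ℝ) else 0) = avg F * (1 / k) := by
  rw [avg_resample _ u, ← avg_mul_const]
  congr 1
  funext f
  have : ∀ c, (F (Function.update f u c) *
      if lab (Function.update f u c u) = lab (Function.update f u c v) then (1 : ℝ) else 0)
      = F f * if lab c = lab (f v) then (1 : ℝ) else 0 := by
    intro c
    rw [hF, Function.update_self, Function.update_of_ne huv.symm]
  simp only [this]
  rw [avg_const_mul, ← frac_eq_avg, hlab _ (hlt _)]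

theorem avg_monochromatic [Nonempty Λ] (hlab : IsUniformLabel lab k) (hlt : ∀ x, lab x < k)
    {e : Sym2 V} (he : ¬ e.IsDiag) :
    avg (fun f : V → Λ => if Monochromatic (fun v => lab (f v)) e then (1 : ℝ) else 0)
      = 1 / k := by
  induction e using Sym2.ind with
  | _ u v =>
    have := avg_mul_label_eq hlab hlt (u := u) (v := v) (by simpa using he) (fun _ => 1)
      (fun _ _ => rfl)
    rw [avg_const] at this
    simpa [Monochromatic] using this

theorem avg_monochromatic_mul [Nonempty Λ] (hlab : IsUniformLabel lab k) (hlt : ∀ x, lab x < k)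
    {e e' : Sym2 V} (he : ¬ e.IsDiag) (he' : ¬ e'.IsDiag) (hne : e ≠ e') :
    avg (fun f : V → Λ => (if Monochromatic (fun v => lab (f v)) e then (1 : ℝ) else 0) *
      if Monochromatic (fun v => lab (f v)) e' then (1 : ℝ) else 0) = 1 / k * (1 / k) := by
  -- Distinct edges share at most one vertex, so `e'` has an endpoint off `e`. Redrawing its label
  -- gives pairwise independence.
  obtain ⟨x, y, rfl, hx⟩ : ∃ x y, e' = s(x, y) ∧ x ∉ e := by
    induction e' using Sym2.ind with
    | _ x y =>
      by_cases hx : x ∈ e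
      · refine ⟨y, x, Sym2.eq_swap, fun hy => hne ?_⟩
        exact (Sym2.mem_and_mem_iff (by simpa using he')).1 ⟨hx, hy⟩
      · exact ⟨x, y, rfl, hx⟩
  have := avg_mul_label_eq hlab hlt (u := x) (v := y) (by simpa using he')
    (fun f => if Monochromatic (fun v => lab (f v)) e then (1 : ℝ) else 0) ?_
  · rw [avg_monochromatic hlab hlt he] at this
    simpa [Monochromatic] using this
  · intro f c
    have : e.map (fun v => lab (Function.update f x c v)) = e.map fun v => lab (f v) := by
      refine Sym2.map_congr fun v hv => ?_
      rw [Function.update_of_ne]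
      rintro rfl
      exact hx hv
    have hm : Monochromatic (fun v => lab (Function.update f x c v)) e ↔
        Monochromatic (fun v => lab (f v)) e := by
      unfold Monochromatic
      rw [this]
    by_cases h : Monochromatic (fun v => lab (f v)) e
    · simp only [h, hm.2 h, if_true]
    · simp only [h, mt hm.1 h, if_false]

/-- Chebyshev: pairwise independence makes the variance at most the mean μ ≤ N/2, and the excess
over the mean is at least N/2. -/
theorem frac_monochromatic_gt_le [Nonempty Λ] (hlab : IsUniformLabel lab k)
    (hlt : ∀ x, lab x < k) (s : Finset (Sym2 V)) (hs : ∀ e ∈ s, ¬ e.IsDiag) {N : ℕ} (hN : 0 < N)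
    (hsN : 2 * s.card ≤ k * N) :
    frac (fun f : V → Λ => N < (s.filter (Monochromatic fun v => lab (f v))).card)
      ≤ 2 / (N : ℝ) := by
  have hk : (0 : ℝ) < k := by
    have : Nonempty Λ := inferInstance
    exact_mod_cast (Nat.zero_le _).trans_lt (hlt (Classical.arbitrary Λ))
  set μ : ℝ := s.card / k with hμ
  set I : Sym2 V → (V → Λ) → ℝ :=
    fun e f => if Monochromatic (fun v => lab (f v)) e then (1 : ℝ) else 0 with hI
  have hN' : (0 : ℝ) < N := by exact_mod_cast hN
  have hμ0 : 0 ≤ μ := by positivity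
  have hμN : μ ≤ N / 2 := by
    rw [hμ, div_le_div_iff₀ hk (by norm_num)]
    have : (2 * s.card : ℝ) ≤ k * N := by exact_mod_cast hsN
    linarith
  have hM : ∀ f, ((s.filter (Monochromatic fun v => lab (f v))).card : ℝ) = ∑ e ∈ s, I e f := by
    intro f
    simp [hI]
  have h1 : avg (fun f => ∑ e ∈ s, I e f) = μ := by
    rw [avg_sum, sum_congr rfl fun e he => avg_monochromatic hlab hlt (hs e he)]
    simp [hμ, div_eq_mul_inv]
  have h2 : avg (fun f => (∑ e ∈ s, I e f) * ∑ e ∈ s, I e f) ≤ μ + μ * μ := by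
    simp only [sum_mul_sum]
    rw [avg_sum]
    calc ∑ e ∈ s, avg (fun f => ∑ e' ∈ s, I e f * I e' f)
        ≤ ∑ e ∈ s, (1 / k + μ * (1 / k) : ℝ) := by
          refine sum_le_sum fun e he => ?_
          rw [avg_sum, ← insert_erase he, sum_insert (notMem_erase _ _)]
          refine add_le_add ?_ ?_
          · have : (fun f => I e f * I e f) = I e := by
              funext f; simp [hI]
            rw [this]
            exact (avg_monochromatic hlab hlt (hs e he)).le
          · have : ∀ e' ∈ s.erase e, avg (fun f => I e f * I e' f) = 1 / k * (1 / k) := by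
              intro e' he'
              exact avg_monochromatic_mul hlab hlt (hs e he) (hs e' (mem_of_mem_erase he'))
                (ne_of_mem_erase he').symm
            rw [sum_congr rfl this, sum_const, nsmul_eq_mul, hμ]
            have hc : ((s.erase e).card : ℝ) ≤ s.card := by exact_mod_cast card_erase_le
            have : (s.card : ℝ) / k * (1 / k) = s.card * (1 / k * (1 / k)) := by ring
            rw [this]
            gcongr
      _ = μ + μ * μ := by
          rw [sum_const, nsmul_eq_mul, hμ]
          ring
  have h3 : avg (fun f => ((∑ e ∈ s, I e f) - μ) ^ 2) ≤ μ := by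
    have : (fun f => ((∑ e ∈ s, I e f) - μ) ^ 2) = fun f =>
        ((∑ e ∈ s, I e f) * (∑ e ∈ s, I e f)) + ((-2 * μ) * (∑ e ∈ s, I e f) + μ * μ) := by
      funext f; ring
    rw [this, avg_add, avg_add, avg_const, avg_const_mul, h1]
    linarith
  have h4 := frac_le_of_markov
    (P := fun f : V → Λ => N < (s.filter (Monochromatic fun v => lab (f v))).card)
    (f := fun f => ((∑ e ∈ s, I e f) - μ) ^ 2) (c := (N / 2) ^ 2) (fun _ => by positivity) ?_
  · have h5 : frac (fun f : V → Λ => N < (s.filter (Monochromatic fun v => lab (f v))).card)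
        * (N / 2) ^ 2 ≤ 2 / N * (N / 2) ^ 2 := by
      have : (2 / N * (N / 2) ^ 2 : ℝ) = N / 2 := by field_simp
      linarith
    exact le_of_mul_le_mul_right h5 (by positivity)
  · intro f hf
    have hf' : (N : ℝ) < ∑ e ∈ s, I e f := by
      rw [← hM]
      exact_mod_cast hf
    have : (N / 2 : ℝ) ≤ (∑ e ∈ s, I e f) - μ := by linarith
    gcongr

/-- The label below `2 ^ a` encoded by `W` bits. -/
def bitLabel (W a : ℕ) (x : Fin W → Bool) : ℕ := Nat.ofBits x % 2 ^ a

theorem bitLabel_lt (W a : ℕ) (x : Fin W → Bool) : bitLabel W a x < 2 ^ a :=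
  Nat.mod_lt _ (by positivity)

theorem isUniformLabel_bitLabel {W a : ℕ} (h : a ≤ W) : IsUniformLabel (bitLabel W a) (2 ^ a) := by
  intro c hc
  obtain ⟨d, rfl⟩ := Nat.exists_eq_add_of_le' h
  -- A uniform number below 2^(d+a) has an independent uniform quotient and remainder modulo 2^a.
  let e : (Fin (d + a) → Bool) ≃ Fin (2 ^ d) × Fin (2 ^ a) :=
    (Equiv.ofBijective (fun x : Fin (d + a) → Bool => Fin.ofBits x) (by
      rw [Fintype.bijective_iff_injective_and_card]
      refine ⟨fun x y hxy => ?_, by simp⟩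
      have hxy : Nat.ofBits x = Nat.ofBits y := congrArg Fin.val hxy
      funext i
      have := congrArg (fun z => Nat.testBit z i) hxy
      simpa using this)).trans ((finCongr (pow_add 2 d a)).trans finProdFinEquiv.symm)
  have h1 : (fun x => bitLabel (d + a) a x = c)
      = fun x => ((Equiv.prodComm _ _) (e x)).1 = (⟨c, hc⟩ : Fin (2 ^ a)) := by
    funext x
    simp [e, bitLabel, Fin.ext_iff, finProdFinEquiv, Fin.modNat]
  rw [h1, frac_equiv e (fun q => ((Equiv.prodComm _ _) q).1 = (⟨c, hc⟩ : Fin (2 ^ a))),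
    frac_equiv (Equiv.prodComm _ _) (fun q : Fin (2 ^ a) × Fin (2 ^ d) => q.1 = ⟨c, hc⟩),
    frac_prod_fst (fun y : Fin (2 ^ a) => y = ⟨c, hc⟩)]
  rw [frac_eq_avg, avg]
  simp

end Labels

/-! ### Local peeling against a label-independent reference. -/

section Peeling

open Finset Classical

variable {V : Type*} [Fintype V] [DecidableEq V]

/-- Neighbours of `v` in `S`. -/
noncomputable def nbrs {V : Type*} (H : V → V → Prop) (v : V) (S : Finset V) : Finset V := S.filter (H v)

theorem mem_nbrs {V : Type*} {H : V → V → Prop} {v u : V} {S : Finset V} :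
    u ∈ nbrs H v S ↔ u ∈ S ∧ H v u := by simp [nbrs]

/-- The vertices removed in the first `l` rounds of peeling with degree thresholds `θ`. -/
noncomputable def peel (H : V → V → Prop) (θ : ℕ → ℕ) : ℕ → Finset V
  | 0 => ∅
  | l + 1 => peel H θ l ∪ univ.filter fun v => θ l ≤ (nbrs H v (peel H θ l)ᶜ).card

theorem exists_adj_of_mem_peel {H : V → V → Prop} {θ : ℕ → ℕ} (hθ : ∀ l, 0 < θ l) {v : V} :
    ∀ {l}, v ∈ peel H θ l → ∃ u, H v u := by
  intro l
  induction l with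
  | zero => simp [peel]
  | succ l ih =>
    intro h
    rw [peel, mem_union] at h
    rcases h with h | h
    · exact ih h
    · have h1 := (hθ l).trans_le (mem_filter.1 h).2
      obtain ⟨u, hu⟩ := card_pos.1 h1
      exact ⟨u, (mem_nbrs.1 hu).2⟩

/-- Reference peeling of the bipartite graph between a vertex cover `O` and its complement, which
does not depend on any random choices: the vertices left on both sides after `l` steps. -/
noncomputable def layers (H : V → V → Prop) (O : Finset V) (δ : ℕ) : ℕ → Finset V × Finset V
  | 0 => (O, Oᶜ)
  | l + 1 =>
    ((layers H O δ l).1.filter fun v => (nbrs H v (layers H O δ l).2).card < 2 ^ (δ - l),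
     (layers H O δ l).2.filter fun v => 2 * (nbrs H v (layers H O δ l).1).card < 2 ^ (δ - l - 1))

variable {H : V → V → Prop} {O : Finset V} {δ : ℕ}

theorem layers_fst_succ_subset (l : ℕ) : (layers H O δ (l + 1)).1 ⊆ (layers H O δ l).1 :=
  filter_subset _ _

theorem layers_snd_succ_subset (l : ℕ) : (layers H O δ (l + 1)).2 ⊆ (layers H O δ l).2 :=
  filter_subset _ _

theorem layers_fst_subset : ∀ l, (layers H O δ l).1 ⊆ O
  | 0 => Subset.rfl
  | l + 1 => (layers_fst_succ_subset l).trans (layers_fst_subset l)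

theorem layers_snd_subset : ∀ l, (layers H O δ l).2 ⊆ Oᶜ
  | 0 => Subset.rfl
  | l + 1 => (layers_snd_succ_subset l).trans (layers_snd_subset l)

/-- The thresholds for local degrees when there are `2 ^ a` label classes. -/
def threshold (δ a : ℕ) (l : ℕ) : ℕ := 2 ^ (δ - l - 1 - a)

theorem threshold_pos (δ a l : ℕ) : 0 < threshold δ a l := by unfold threshold; positivity

/-- Peeling inside balanced label classes removes everything that the reference peeling removes
from the vertex cover, and nothing that the reference peeling keeps outside of it. -/
theorem peel_sandwich {F : V → V → Prop} {g : V → ℕ} {W : V → Prop} {a L θ : ℕ}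
    (hF : ∀ v, W v → ∀ u, F v u ↔ H v u ∧ g u = g v)
    (hW : ∀ u v, W v → g u = g v → W u)
    (hO : ∀ u v, H u v → u ∈ O ∨ v ∈ O) (hg : ∀ v, g v < 2 ^ a)
    (hθ : ∀ l < L, l + 1 + a ≤ δ ∧ θ ≤ threshold δ a l)
    (hbal : ∀ l < L, ∀ v, Balanced (2 ^ a) θ g (nbrs H v (layers H O δ l).1) ∧
      Balanced (2 ^ a) θ g (nbrs H v (layers H O δ l).2)) :
    ∀ l ≤ L, ∀ v, W v →
      (v ∈ O → v ∉ peel F (threshold δ a) l → v ∈ (layers H O δ l).1) ∧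
      (v ∈ (layers H O δ l).2 → v ∉ peel F (threshold δ a) l) := by
  have hcount : ∀ v, W v → ∀ S, labelCount g (nbrs H v S) (g v) = (nbrs F v S).card := by
    intro v hv S
    unfold labelCount
    congr 1
    ext u
    simp only [mem_filter, mem_nbrs, hF v hv]
    tauto
  intro l
  induction l with
  | zero =>
    intro _ v _
    exact ⟨fun h _ => h, fun _ => by simp [peel]⟩
  | succ l ih =>
    intro hl v hv
    have ih := ih (by omega)
    obtain ⟨hδ, hθl⟩ := hθ l (by omega)
    obtain ⟨hbX, hbY⟩ := hbal l (by omega) v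
    have hpow1 : 2 ^ (δ - l) = 2 * 2 ^ a * threshold δ a l := by
      rw [threshold, mul_assoc, ← pow_add, ← pow_succ']
      congr 1
      omega
    have hpow2 : 2 ^ (δ - l - 1) = 2 ^ a * threshold δ a l := by
      rw [threshold, ← pow_add]
      congr 1
      omega
    constructor
    · intro hvO hvp
      rw [peel, mem_union, not_or, mem_filter] at hvp
      have hvX := (ih v hv).1 hvO hvp.1
      refine mem_filter.2 ⟨hvX, ?_⟩
      by_contra hlt
      -- If the reference drops `v`, it has at least twice the scaled-up threshold many neighbours
      -- in the outer layer, so balance puts a full threshold of them into its own class. All of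
      -- these survive by induction.
      have h1 := (hbY _ (hg v) _ hθl).2 (by omega)
      rw [hcount v hv] at h1
      have h2 : (nbrs F v (layers H O δ l).2) ⊆ nbrs F v (peel F (threshold δ a) l)ᶜ := by
        intro u hu
        obtain ⟨huY, hFu⟩ := mem_nbrs.1 hu
        refine mem_nbrs.2 ⟨mem_compl.2 ?_, hFu⟩
        exact (ih u (hW u v hv ((hF v hv u).1 hFu).2)).2 huY
      exact hvp.2 ⟨mem_univ _, h1.trans (card_le_card h2)⟩
    · intro hvY
      obtain ⟨hvY, hdeg⟩ := mem_filter.1 hvY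
      rw [peel, mem_union, not_or, mem_filter]
      refine ⟨(ih v hv).2 hvY, fun hlt => ?_⟩
      -- Here `v` has less than half the scaled-up threshold many neighbours in the inner layer, so
      -- its local count stays below the threshold.
      have h1 := (hbX _ (hg v) _ hθl).1 (by omega)
      rw [hcount v hv] at h1
      have h2 : nbrs F v (peel F (threshold δ a) l)ᶜ ⊆ nbrs F v (layers H O δ l).1 := by
        intro u hu
        obtain ⟨hup, hFu⟩ := mem_nbrs.1 hu
        have hHu := (hF v hv u).1 hFu
        -- The complement of a cover is independent, so every surviving neighbour of `v` lies in
        -- `O`, hence in the inner layer by induction.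
        have hvO : v ∉ O := mem_compl.1 (layers_snd_subset l hvY)
        exact mem_nbrs.2 ⟨(ih u (hW u v hv hHu.2)).1 ((hO v u hHu.1).resolve_left hvO)
          (mem_compl.1 hup), hFu⟩
      have := hlt.2.trans (card_le_card h2)
      omega

theorem card_mul_le_of_nbrs {V : Type*} {H : V → V → Prop} (hsymm : ∀ u v, H u v → H v u)
    {S T X : Finset V} (hST : S ⊆ T)
    {d D : ℕ} (hS : ∀ y ∈ S, d ≤ (nbrs H y X).card) (hX : ∀ x ∈ X, (nbrs H x T).card ≤ D) :
    S.card * d ≤ X.card * D := by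
  refine card_mul_le_card_mul H (fun y hy => ?_) (fun x hx => ?_)
  · exact (hS y hy).trans (card_le_card fun u hu => by
      simpa [bipartiteAbove] using mem_nbrs.1 hu)
  · refine (card_le_card fun u hu => ?_).trans (hX x hx)
    have := mem_filter.1 hu
    exact mem_nbrs.2 ⟨hST this.1, hsymm _ _ this.2⟩

/-- Initially this is the global degree bound; later, a vertex that passed the previous step has few
neighbours in the outer layer, which only shrinks. -/
theorem card_nbrs_layers_le (hdeg : ∀ v, (nbrs H v univ).card < 2 ^ δ) {l : ℕ} (hl : l ≤ δ) {v : V}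
    (hv : v ∈ (layers H O δ l).1) : (nbrs H v (layers H O δ l).2).card ≤ 2 ^ (δ - l + 1) := by
  cases l with
  | zero =>
    have h1 : (nbrs H v (layers H O δ 0).2).card ≤ (nbrs H v univ).card :=
      card_le_card (filter_subset_filter _ (subset_univ _))
    have h2 : 2 ^ δ ≤ 2 ^ (δ - 0 + 1) := Nat.pow_le_pow_right (by norm_num) (by omega)
    exact (h1.trans (hdeg v).le).trans h2
  | succ l =>
    have h1 := (mem_filter.1 hv).2
    have h2 : (nbrs H v (layers H O δ (l + 1)).2).card ≤ (nbrs H v (layers H O δ l).2).card :=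
      card_le_card (filter_subset_filter _ (layers_snd_succ_subset l))
    rw [show δ - (l + 1) + 1 = δ - l by omega]
    omega

/-- Each level loses at most 8|O| outer vertices: a dropped one has at least 2^(δ-l-1)/2 neighbours
in the inner layer, whose vertices have at most 4·2^(δ-l-1) neighbours back. -/
theorem card_compl_sdiff_layers_le (hsymm : ∀ u v, H u v → H v u)
    (hdeg : ∀ v, (nbrs H v univ).card < 2 ^ δ) :
    ∀ l ≤ δ, (Oᶜ \ (layers H O δ l).2).card ≤ 8 * l * O.card := by
  intro l
  induction l with
  | zero => simp [layers]
  | succ l ih =>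
    intro hl
    have ih := ih (by omega)
    have hsub : Oᶜ \ (layers H O δ (l + 1)).2
        ⊆ (Oᶜ \ (layers H O δ l).2) ∪ ((layers H O δ l).2 \ (layers H O δ (l + 1)).2) := by
      intro v
      simp only [mem_union, mem_sdiff]
      tauto
    have hbad : ((layers H O δ l).2 \ (layers H O δ (l + 1)).2).card ≤ 8 * O.card := by
      -- The half is rounded up, so that the count stays positive at the last level, where 2^(δ-l-1)
      -- = 1.
      have h1 := card_mul_le_of_nbrs (X := (layers H O δ l).1) hsymm
        (sdiff_subset : (layers H O δ l).2 \ (layers H O δ (l + 1)).2 ⊆ _)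
        (d := (2 ^ (δ - l - 1) + 1) / 2) (D := 2 ^ (δ - l + 1)) (fun y hy => by
          rw [mem_sdiff, layers, mem_filter, not_and] at hy
          have := hy.2 hy.1
          omega) (fun x hx => card_nbrs_layers_le hdeg (by omega) hx)
      have h2 : 2 ^ (δ - l + 1) = 4 * 2 ^ (δ - l - 1) := by
        rw [show δ - l + 1 = (δ - l - 1) + 2 by omega, pow_add]
        ring
      have h3 : (layers H O δ l).1.card ≤ O.card := card_le_card (layers_fst_subset l)
      have hpos : 0 < (2 ^ (δ - l - 1) + 1) / 2 := by
        have : 0 < 2 ^ (δ - l - 1) := by positivity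
        omega
      refine Nat.le_of_mul_le_mul_right ?_ hpos
      calc _ ≤ (layers H O δ l).1.card * 2 ^ (δ - l + 1) := h1
        _ ≤ O.card * (8 * ((2 ^ (δ - l - 1) + 1) / 2)) := by
          refine Nat.mul_le_mul h3 ?_
          omega
        _ = _ := by ring
    calc _ ≤ _ := card_le_card hsub
      _ ≤ _ := card_union_le _ _
      _ ≤ 8 * l * O.card + 8 * O.card := add_le_add ih hbad
      _ = _ := by ring

/-- The edges of `H` inside the label classes simulated by machine `j`. -/
def classGraph (H : V → V → Prop) (g : V → ℕ) (p j : ℕ) (v u : V) : Prop :=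
  H v u ∧ g u = g v ∧ g v % p = j

/-- The vertices peeled by some machine. -/
noncomputable def peeled (H : V → V → Prop) (g : V → ℕ) (p : ℕ) (θ : ℕ → ℕ) (L : ℕ) : Finset V :=
  univ.filter fun v => ∃ j : Fin p, v ∈ peel (classGraph H g p j) θ L

/-- The graph without the vertices of `R`. -/
def alive (G : V → V → Prop) (R : Finset V) (u v : V) : Prop := G u v ∧ u ∉ R ∧ v ∉ R

/-- The vertices of degree at least `τ` in what is left of `G` without `R`. -/
noncomputable def heavy (G : V → V → Prop) (R : Finset V) (τ : ℕ) : Finset V :=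
  univ.filter fun v => τ ≤ (nbrs (alive G R) v univ).card

/-- The edges at `v` live only on machine `g v % p`, so `peel_sandwich` for that machine decides the
fate of `v`. -/
theorem peeled_sandwich {g : V → ℕ} {p a L θ : ℕ} (hp : 0 < p)
    (hO : ∀ u v, H u v → u ∈ O ∨ v ∈ O) (hg : ∀ v, g v < 2 ^ a)
    (hθ : ∀ l < L, l + 1 + a ≤ δ ∧ θ ≤ threshold δ a l)
    (hbal : ∀ l < L, ∀ v, Balanced (2 ^ a) θ g (nbrs H v (layers H O δ l).1) ∧
      Balanced (2 ^ a) θ g (nbrs H v (layers H O δ l).2)) (v : V) :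
    (v ∈ O → v ∉ peeled H g p (threshold δ a) L → v ∈ (layers H O δ L).1) ∧
      (v ∈ (layers H O δ L).2 → v ∉ peeled H g p (threshold δ a) L) := by
  have key := fun j : ℕ => peel_sandwich (F := classGraph H g p j) (W := fun v => g v % p = j)
    (fun v hv u => by simp only [classGraph, hv, and_true])
    (fun u v hv huv => by simpa only [huv] using hv) hO hg hθ hbal L le_rfl v
  constructor
  · intro hvO hvP
    refine (key (g v % p) rfl).1 hvO fun h => hvP ?_
    exact mem_filter.2 ⟨mem_univ _, ⟨g v % p, Nat.mod_lt _ hp⟩, h⟩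
  · intro hvY hvP
    obtain ⟨j, hj⟩ := (mem_filter.1 hvP).2
    -- Thresholds are positive, so a vertex peeled on machine `j` has an edge there and `j` is its
    -- own machine.
    obtain ⟨u, hu⟩ := exists_adj_of_mem_peel (threshold_pos δ a) hj
    exact (key j hu.2.2).2 hvY hj

/-- Vertices outside `O` leave because they were gone before, because the reference dropped them, or
because they are heavy in the last outer layer. The remaining neighbours of the latter lie in the
last inner layer, so double counting bounds their number by 4|O|. -/
theorem card_phase_sdiff_le {G : V → V → Prop} {R : Finset V} (hsymm : ∀ u v, G u v → G v u)
    {g : V → ℕ} {p a L θ : ℕ} (hp : 0 < p) (hL : L ≤ δ)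
    (hO : ∀ u v, G u v → u ∈ O ∨ v ∈ O) (hg : ∀ v, g v < 2 ^ a)
    (hdeg : ∀ v, (nbrs (alive G R) v univ).card < 2 ^ δ)
    (hθ : ∀ l < L, l + 1 + a ≤ δ ∧ θ ≤ threshold δ a l)
    (hbal : ∀ l < L, ∀ v, Balanced (2 ^ a) θ g (nbrs (alive G R) v (layers (alive G R) O δ l).1) ∧
      Balanced (2 ^ a) θ g (nbrs (alive G R) v (layers (alive G R) O δ l).2))
    {Q : Finset V} (hQ : Q = R ∪ peeled (alive G R) g p (threshold δ a) L) :
    ((Q ∪ heavy G Q (2 ^ (δ - L - 1))) \ O).card ≤ (R \ O).card + 8 * (L + 1) * O.card := by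
  set H := alive G R with hH
  have hHs : ∀ u v, H u v → H v u := fun u v h => ⟨hsymm _ _ h.1, h.2.2, h.2.1⟩
  have hHO : ∀ u v, H u v → u ∈ O ∨ v ∈ O := fun u v h => hO u v h.1
  have hsw := peeled_sandwich hp hHO hg hθ hbal
  set S := (layers H O δ L).2.filter fun w => 2 ^ (δ - L - 1) ≤ (nbrs H w (layers H O δ L).1).card
    with hS
  have hsub : (Q ∪ heavy G Q (2 ^ (δ - L - 1))) \ O
      ⊆ ((R \ O) ∪ (Oᶜ \ (layers H O δ L).2)) ∪ S := by
    intro v hv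
    obtain ⟨hv, hvO⟩ := mem_sdiff.1 hv
    by_cases hvY : v ∈ (layers H O δ L).2
    · by_cases hvR : v ∈ R
      · exact mem_union_left _ (mem_union_left _ (mem_sdiff.2 ⟨hvR, hvO⟩))
      · have hvP := (hsw v).2 hvY
        have hvQ : v ∉ Q := by
          rw [hQ, mem_union, not_or]
          exact ⟨hvR, hvP⟩
        have hvN := (mem_filter.1 ((mem_union.1 hv).resolve_left hvQ)).2
        refine mem_union_right _ (mem_filter.2 ⟨hvY, hvN.trans (card_le_card fun u hu => ?_)⟩)
        obtain ⟨-, hGu, -, huQ⟩ := mem_nbrs.1 hu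
        rw [hQ, mem_union, not_or] at huQ
        exact mem_nbrs.2 ⟨(hsw u).1 ((hO v u hGu).resolve_left hvO) huQ.2, hGu, hvR, huQ.1⟩
    · exact mem_union_left _ (mem_union_right _ (mem_sdiff.2 ⟨mem_compl.2 hvO, hvY⟩))
  have hScard : S.card ≤ 4 * O.card := by
    have h1 := card_mul_le_of_nbrs (X := (layers H O δ L).1) hHs
      (filter_subset _ _ : S ⊆ (layers H O δ L).2)
      (d := 2 ^ (δ - L - 1)) (D := 2 ^ (δ - L + 1)) (fun y hy => (mem_filter.1 hy).2)
      (fun x hx => card_nbrs_layers_le hdeg hL hx)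
    have h2 : 2 ^ (δ - L + 1) ≤ 4 * 2 ^ (δ - L - 1) := by
      rw [show 4 * 2 ^ (δ - L - 1) = 2 ^ (δ - L - 1 + 2) by rw [pow_add]; ring]
      exact Nat.pow_le_pow_right (by norm_num) (by omega)
    have h3 : (layers H O δ L).1.card ≤ O.card := card_le_card (layers_fst_subset L)
    refine Nat.le_of_mul_le_mul_right ?_ (by positivity : 0 < 2 ^ (δ - L - 1))
    calc _ ≤ (layers H O δ L).1.card * 2 ^ (δ - L + 1) := h1
      _ ≤ O.card * (4 * 2 ^ (δ - L - 1)) := Nat.mul_le_mul h3 h2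
      _ = _ := by ring
  have hY := card_compl_sdiff_layers_le (O := O) hHs hdeg L hL
  calc _ ≤ _ := card_le_card hsub
    _ ≤ _ := card_union_le _ _
    _ ≤ ((R \ O).card + 8 * L * O.card) + 4 * O.card := by
      refine add_le_add ((card_union_le _ _).trans ?_) hScard
      exact Nat.add_le_add_left hY _
    _ ≤ _ := by nlinarith

/-- What is left after removing the heavy vertices has small degrees. -/
theorem card_nbrs_alive_union_heavy_lt (G : V → V → Prop) (Q : Finset V) {τ : ℕ} (hτ : 0 < τ)
    (v : V) : (nbrs (alive G (Q ∪ heavy G Q τ)) v univ).card < τ := by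
  by_cases hv : v ∈ Q ∪ heavy G Q τ
  · rw [nbrs, filter_false_of_mem]
    · simpa using hτ
    · exact fun u _ h => h.2.1 hv
  · have h1 : ¬ τ ≤ (nbrs (alive G Q) v univ).card := fun h =>
      hv (mem_union_right _ (mem_filter.2 ⟨mem_univ _, h⟩))
    refine lt_of_le_of_lt (card_le_card fun u hu => ?_) (not_le.1 h1)
    obtain ⟨-, hG, h2, h3⟩ := mem_nbrs.1 hu
    exact mem_nbrs.2 ⟨mem_univ _, hG, fun h => h2 (mem_union_left _ h),
      fun h => h3 (mem_union_left _ h)⟩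

end Peeling

/-! ### Phase lengths, label ranges and the probability of good labels. -/

section Schedule

open Finset Classical

/-- Iterated binary logarithm. -/
def loglog (n : ℕ) : ℕ := Nat.log 2 (Nat.log 2 n)

/-- Local degrees are only compared with thresholds of at least `2 ^ slack n`. -/
def slack (n : ℕ) : ℕ := loglog n + 8

/-- Number of phases. -/
def phases (n : ℕ) : ℕ := 3 * loglog n + 19

/-- Number of label bits of a phase that starts with degrees below `2 ^ δ`. -/
def labelBits (n m r δ : ℕ) : ℕ := if r = 0 then Nat.clog 2 (m / n + 1) + 1 else (δ + 1) / 2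

/-- At the beginning of phase `r` all degrees are below `2 ^ degBits n m r`. -/
def degBits (n m : ℕ) : ℕ → ℕ
  | 0 => Nat.log 2 n + 1
  | r + 1 => degBits n m r - (degBits n m r - (labelBits n m r (degBits n m r) + slack n)) - 1

/-- Number of label bits in phase `r`. -/
def bits (n m r : ℕ) : ℕ := labelBits n m r (degBits n m r)

/-- Number of peeling steps that are simulated locally in phase `r`. -/
def levels (n m r : ℕ) : ℕ := degBits n m r - (bits n m r + slack n)

variable {n m : ℕ}

theorem degBits_succ (n m r : ℕ) :
    degBits n m (r + 1) = degBits n m r - levels n m r - 1 := rfl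

theorem levels_le (n m r : ℕ) : levels n m r ≤ degBits n m r := Nat.sub_le _ _

theorem degBits_le (n m : ℕ) : ∀ r, degBits n m r ≤ Nat.log 2 n + 1
  | 0 => le_rfl
  | r + 1 => by
    have := degBits_le n m r
    rw [degBits_succ]
    omega

theorem sum_levels_add_degBits_le (n m : ℕ) :
    ∀ r, ∑ i ∈ range r, levels n m i + degBits n m r ≤ Nat.log 2 n + 1
  | 0 => by simp [degBits]
  | r + 1 => by
    have h1 := sum_levels_add_degBits_le n m r
    have h2 := levels_le n m r
    rw [sum_range_succ, degBits_succ]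
    omega

/-- After phase 0 the exponent δ becomes at most about δ/2 + `slack n`, an affine contraction with
fixed point near `2 * slack n`. -/
theorem degBits_succ_le_add_div (n m : ℕ) :
    ∀ i, degBits n m (i + 1) ≤ 2 * slack n + (Nat.log 2 n + 1) / 2 ^ i
  | 0 => by
    have := degBits_le n m 1
    simp only [zero_add, pow_zero, Nat.div_one]
    omega
  | i + 1 => by
    have h1 := degBits_succ_le_add_div n m i
    have h2 : bits n m (i + 1) = (degBits n m (i + 1) + 1) / 2 := by
      simp [bits, labelBits]
    have h3 : 8 ≤ slack n := by unfold slack; omega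
    rw [degBits_succ, levels, h2, pow_succ, ← Nat.div_div_eq_div_mul]
    omega

theorem degBits_phases (n m : ℕ) : degBits n m (phases n) = 0 := by
  have h1 : degBits n m (loglog n + 3) ≤ 2 * slack n := by
    have h := degBits_succ_le_add_div n m (loglog n + 2)
    have h2 : Nat.log 2 n < 2 ^ (loglog n + 1) := Nat.lt_pow_succ_log_self (by norm_num) _
    have h3 : (Nat.log 2 n + 1) / 2 ^ (loglog n + 2) = 0 := by
      rw [Nat.div_eq_zero_iff]
      right
      have : 1 ≤ 2 ^ (loglog n + 1) := Nat.one_le_two_pow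
      rw [show loglog n + 2 = loglog n + 1 + 1 by omega, pow_succ]
      omega
    rw [h3] at h
    exact h
  -- Below `2 * slack n` only the removal of heavy vertices is relied upon, which lowers the
  -- exponent by at least one per phase.
  have h2 : ∀ j, degBits n m (loglog n + 3 + j) ≤ 2 * slack n - j := by
    intro j
    induction j with
    | zero => simpa using h1
    | succ j ih =>
      rw [← add_assoc, degBits_succ]
      omega
  have h3 := h2 (2 * slack n)
  have h4 : loglog n + 3 + 2 * slack n = phases n := by
    unfold slack phases
    omega
  rw [h4] at h3
  omega

theorem threshold_of_lt_levels {r l : ℕ} (hl : l < levels n m r) :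
    l + 1 + bits n m r ≤ degBits n m r ∧
      2 ^ slack n ≤ threshold (degBits n m r) (bits n m r) l := by
  unfold levels at hl
  refine ⟨by omega, ?_⟩
  exact Nat.pow_le_pow_right (by norm_num) (by omega)

/-- Enough labels for the expected number of monochromatic edges in phase 0 to be at most n/2. -/
theorem two_mul_le_two_pow_bits_zero (n m : ℕ) : 2 * (m / n + 1) ≤ 2 ^ bits n m 0 := by
  have : m / n + 1 ≤ 2 ^ Nat.clog 2 (m / n + 1) := Nat.le_pow_clog (by norm_num) _
  simp only [bits, labelBits, if_true, pow_succ]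
  omega

theorem two_pow_bits_zero_le (n m : ℕ) : 2 ^ bits n m 0 ≤ 4 * (m / n + 1) := by
  simp only [bits, labelBits, if_true, pow_succ]
  rcases Nat.eq_zero_or_pos (m / n) with h | h
  · simp [h]
  · have h1 : 2 ^ (Nat.clog 2 (m / n + 1)).pred < m / n + 1 :=
      Nat.pow_pred_clog_lt_self (by norm_num) (by omega)
    have h2 : 0 < Nat.clog 2 (m / n + 1) := Nat.clog_pos (by norm_num) (by omega)
    have h3 : 2 ^ Nat.clog 2 (m / n + 1) = 2 ^ (Nat.clog 2 (m / n + 1)).pred * 2 := by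
      rw [← pow_succ]
      congr 1
      simp only [Nat.pred_eq_sub_one]
      omega
    omega

/-- Later phases that peel at all use at most as many classes as machines: `bits n m r + slack n` is
below the degree exponent, which phase 0 has brought down to at most `bits n m 0 + slack n - 1`. -/
theorem two_pow_bits_le {r : ℕ} (hr : r ≠ 0) (hL : 0 < levels n m r) :
    2 ^ bits n m r ≤ m / n + 1 := by
  have h1 : degBits n m r ≤ degBits n m 1 := by
    obtain ⟨i, rfl⟩ := Nat.exists_eq_succ_of_ne_zero hr
    clear hr hL
    induction i with
    | zero => exact le_rfl
    | succ i ih =>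
      refine le_trans ?_ ih
      change degBits n m (i + 1 + 1) ≤ degBits n m (i + 1)
      rw [degBits_succ]
      omega
  have h2 : degBits n m 1 ≤ bits n m 0 + slack n - 1 := by
    rw [degBits_succ, levels]
    omega
  have h3 : bits n m r = (degBits n m r + 1) / 2 := by simp [bits, labelBits, hr]
  unfold levels at hL
  have h4 : bits n m r + 2 ≤ bits n m 0 := by omega
  have h5 : 2 ^ (bits n m r + 2) ≤ 2 ^ bits n m 0 := Nat.pow_le_pow_right (by norm_num) h4
  have h6 := two_pow_bits_zero_le n m
  rw [pow_add] at h5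
  omega

theorem two_pow_degBits_le {r : ℕ} (hr : r ≠ 0) :
    2 ^ degBits n m r ≤ 2 ^ bits n m r * 2 ^ bits n m r := by
  have h3 : bits n m r = (degBits n m r + 1) / 2 := by simp [bits, labelBits, hr]
  rw [← pow_add]
  exact Nat.pow_le_pow_right (by norm_num) (by omega)

/-- Here 2^`slack n` is at least 128 times the binary logarithm, (5/6)^4 ≤ 1/2, and n ≤ 2^(2 log n).
-/
theorem five_sixths_pow_slack_le (hn : 3 ≤ n) :
    (5 / 6 : ℝ) ^ (2 ^ slack n) ≤ 1 / (n : ℝ) ^ 16 := by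
  have hl : 1 ≤ Nat.log 2 n := Nat.log_pos (by norm_num) (by omega)
  have h1 : Nat.log 2 n < 2 ^ (loglog n + 1) := Nat.lt_pow_succ_log_self (by norm_num) _
  have h2 : 4 * (32 * Nat.log 2 n) ≤ 2 ^ slack n := by
    have : 2 ^ slack n = 2 ^ (loglog n + 1) * 2 ^ 7 := by rw [← pow_add]; rfl
    omega
  have h3 : (n : ℝ) ≤ 2 ^ (2 * Nat.log 2 n) := by
    have h4 : n < 2 ^ (Nat.log 2 n + 1) := Nat.lt_pow_succ_log_self (by norm_num) _
    have h5 : 2 ^ (Nat.log 2 n + 1) ≤ 2 ^ (2 * Nat.log 2 n) :=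
      Nat.pow_le_pow_right (by norm_num) (by omega)
    exact_mod_cast h4.le.trans h5
  have hn0 : (0 : ℝ) < n := by exact_mod_cast (by omega : 0 < n)
  calc (5 / 6 : ℝ) ^ (2 ^ slack n) ≤ (5 / 6) ^ (4 * (32 * Nat.log 2 n)) :=
        pow_le_pow_of_le_one (by norm_num) (by norm_num) h2
    _ = ((5 / 6) ^ 4) ^ (32 * Nat.log 2 n) := pow_mul _ _ _
    _ ≤ (1 / 2) ^ (32 * Nat.log 2 n) := by gcongr; norm_num
    _ = 1 / (2 ^ (2 * Nat.log 2 n)) ^ 16 := by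
        rw [← pow_mul, one_div_pow]
        congr 2
        ring
    _ ≤ 1 / (n : ℝ) ^ 16 := by gcongr

/-- The vertex sets whose distribution over the label classes matters in a phase. -/
noncomputable def relevantSets {V : Type*} [Fintype V] [DecidableEq V] (H : V → V → Prop)
    (O : Finset V) (δ L : ℕ) : Finset (Finset V) :=
  ((range L ×ˢ univ).image fun q : ℕ × V => nbrs H q.2 (layers H O δ q.1).1) ∪
    ((range L ×ˢ univ).image fun q : ℕ × V => nbrs H q.2 (layers H O δ q.1).2) ∪
    (univ.image fun v => nbrs H v univ) ∪ {univ}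

theorem card_relevantSets_le {V : Type*} [Fintype V] [DecidableEq V] (H : V → V → Prop)
    (O : Finset V) (δ L : ℕ) : (relevantSets H O δ L).card
      ≤ L * Fintype.card V + L * Fintype.card V + Fintype.card V + 1 := by
  unfold relevantSets
  refine (card_union_le _ _).trans (add_le_add ?_ (by simp))
  refine (card_union_le _ _).trans (add_le_add ?_ card_image_le)
  refine (card_union_le _ _).trans (add_le_add ?_ ?_) <;>
  · refine card_image_le.trans ?_
    simp

/-- The edges of `H` that machine `j` receives. -/
noncomputable def classEdges {V : Type*} [Fintype V] [DecidableEq V] (H : V → V → Prop)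
    (g : V → ℕ) (p j : ℕ) : Finset (Sym2 V) :=
  univ.filter fun e => ∃ u v, e = s(u, v) ∧ classGraph H g p j u v

theorem mem_classEdges {V : Type*} [Fintype V] [DecidableEq V] {H : V → V → Prop}
    {g : V → ℕ} {p j : ℕ} {e : Sym2 V} :
    e ∈ classEdges H g p j ↔ ∃ u v, e = s(u, v) ∧ classGraph H g p j u v := by
  simp [classEdges]

/-- The labels are such that the local simulation of phase `r` succeeds. -/
def GoodLabels (n m r : ℕ) (H : Fin n → Fin n → Prop) (O : Finset (Fin n)) (g : Fin n → ℕ) :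
    Prop :=
  0 < levels n m r →
    (∀ S ∈ relevantSets H O (degBits n m r) (levels n m r),
      Balanced (2 ^ bits n m r) (2 ^ slack n) g S) ∧
    ∀ j, (classEdges H g (m / n + 1) j).card ≤ 4 * n

/-- One class per machine: balance allows at most 2n/k vertices in it, each of local degree at most
2·2^δ/k ≤ 2k. -/
theorem card_classEdges_le {r : ℕ} (hr : r ≠ 0) (hn : 3 ≤ n) (hL : 0 < levels n m r)
    {H : Fin n → Fin n → Prop} {O : Finset (Fin n)} {g : Fin n → ℕ}
    (hg : ∀ v, g v < 2 ^ bits n m r) (hdeg : ∀ v, (nbrs H v univ).card < 2 ^ degBits n m r)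
    (hbal : ∀ S ∈ relevantSets H O (degBits n m r) (levels n m r),
      Balanced (2 ^ bits n m r) (2 ^ slack n) g S) (j : ℕ) :
    (classEdges H g (m / n + 1) j).card ≤ 4 * n := by
  set k := 2 ^ bits n m r with hk
  set δ := degBits n m r with hδ
  have hk0 : 0 < k := by positivity
  have hkp : k ≤ m / n + 1 := two_pow_bits_le hr hL
  have hδk : 2 ^ δ ≤ k * k := two_pow_degBits_le hr
  have hδn : 2 ^ δ ≤ 2 * n := by
    calc 2 ^ δ ≤ 2 ^ (Nat.log 2 n + 1) := Nat.pow_le_pow_right (by norm_num) (degBits_le n m r)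
      _ ≤ 2 * n := by
        rw [pow_succ, mul_comm]
        exact Nat.mul_le_mul_left _ (Nat.pow_log_le_self 2 (by omega))
  have hδa : bits n m r + slack n < δ := by
    unfold levels at hL
    omega
  have hT : k * 2 ^ (δ - bits n m r) = 2 ^ δ := by
    rw [hk, ← pow_add]
    congr 1
    omega
  have hslack : 2 ^ slack n ≤ 2 ^ (δ - bits n m r) :=
    Nat.pow_le_pow_right (by norm_num) (by omega)
  have hmod : ∀ v, g v % (m / n + 1) = g v := fun v => Nat.mod_eq_of_lt ((hg v).trans_le hkp)
  by_cases hj : j < k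
  swap
  · have hempty : classEdges H g (m / n + 1) j = ∅ := by
      refine eq_empty_of_forall_notMem fun e he => ?_
      obtain ⟨u, v, -, -, -, h⟩ := mem_classEdges.1 he
      rw [hmod] at h
      exact hj (h ▸ hg u)
    rw [hempty, card_empty]
    omega
  have hclass : labelCount g univ j ≤ 2 * n / k := by
    have h1 := (hbal univ (by simp [relevantSets]) j hj (2 * n / k + 1) ?_).1 ?_
    · omega
    · have : 2 ^ (δ - bits n m r) ≤ 2 * n / k := by
        rw [Nat.le_div_iff_mul_le hk0, mul_comm, hT]
        exact hδn
      omega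
    · rw [card_univ, Fintype.card_fin]
      exact (Nat.lt_mul_div_succ _ hk0).le
  have hdegc : ∀ v, labelCount g (nbrs H v univ) j ≤ 2 * 2 ^ (δ - bits n m r) := by
    intro v
    refine ((hbal (nbrs H v univ) ?_ j hj (2 * 2 ^ (δ - bits n m r)) (by omega)).1 ?_).le
    · simp [relevantSets]
    · have := hdeg v
      calc 2 * (nbrs H v univ).card ≤ 2 * 2 ^ δ := by omega
        _ = _ := by rw [← hT]; ring
  have hsub : classEdges H g (m / n + 1) j ⊆
      ((univ.filter fun u => g u = j).sigma fun v =>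
        (nbrs H v univ).filter fun u => g u = j).image fun q => s(q.1, q.2) := by
    intro e he
    obtain ⟨u, v, rfl, hH, huv, hj'⟩ := mem_classEdges.1 he
    rw [hmod] at hj'
    refine mem_image.2 ⟨⟨u, v⟩, ?_, rfl⟩
    simp [mem_nbrs, hH, hj', huv]
  calc (classEdges H g (m / n + 1) j).card
      ≤ _ := (card_le_card hsub).trans card_image_le
    _ = ∑ v ∈ univ.filter (fun u => g u = j), labelCount g (nbrs H v univ) j := by
        rw [card_sigma]
        rfl
    _ ≤ ∑ v ∈ univ.filter (fun u => g u = j), 2 * 2 ^ (δ - bits n m r) :=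
        sum_le_sum fun v _ => hdegc v
    _ = labelCount g univ j * (2 * 2 ^ (δ - bits n m r)) := by
        rw [sum_const, smul_eq_mul]
        rfl
    _ ≤ (2 * n / k) * (2 * k) := by
        refine Nat.mul_le_mul hclass (Nat.mul_le_mul_left _ ?_)
        rw [← hT] at hδk
        exact Nat.le_of_mul_le_mul_left hδk hk0
    _ = 2 * (2 * n / k * k) := by ring
    _ ≤ 2 * (2 * n) := Nat.mul_le_mul_left _ (Nat.div_mul_le_self _ _)
    _ = 4 * n := by ring

/-- Union bound over at most 4n² sets, 4n classes and 2n thresholds, each failing with probability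
at most 2/n^16. -/
theorem frac_exists_not_balanced_le {r W : ℕ} (hW : bits n m r ≤ W) (hn : 3 ≤ n)
    (hmn : m / n + 1 ≤ n) (hL : 0 < levels n m r) (H : Fin n → Fin n → Prop)
    (O : Finset (Fin n)) :
    frac (fun f : Fin n → Fin W → Bool =>
      ∃ S ∈ relevantSets H O (degBits n m r) (levels n m r),
        ¬ Balanced (2 ^ bits n m r) (2 ^ slack n) (fun v => bitLabel W (bits n m r) (f v)) S)
      ≤ 1 / (n : ℝ) ^ 2 := by
  have hn0 : (0 : ℝ) < n := by exact_mod_cast (by omega : 0 < n)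
  have hn3 : (3 : ℝ) ≤ n := by exact_mod_cast hn
  refine (frac_exists_le _ _ fun S _ => frac_not_balanced_le
    (isUniformLabel_bitLabel hW) S _).trans ?_
  have h1 : ((relevantSets H O (degBits n m r) (levels n m r)).card : ℝ) ≤ 4 * (n : ℝ) ^ 2 := by
    have h2 := card_relevantSets_le H O (degBits n m r) (levels n m r)
    rw [Fintype.card_fin] at h2
    have h3 : levels n m r ≤ n := by
      have h4 := (levels_le n m r).trans (degBits_le n m r)
      have h5 : Nat.log 2 n < n := Nat.log_lt_self 2 (by omega)
      omega
    have h4 : (relevantSets H O (degBits n m r) (levels n m r)).card ≤ 4 * n ^ 2 := by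
      nlinarith
    exact_mod_cast h4
  have h2 : ((2 ^ bits n m r : ℕ) : ℝ) ≤ 4 * n := by
    have : 2 ^ bits n m r ≤ 4 * n := by
      by_cases hr : r = 0
      · subst hr
        exact (two_pow_bits_zero_le n m).trans (by omega)
      · exact (two_pow_bits_le hr hL).trans (by omega)
    exact_mod_cast this
  have h3 : ((Fintype.card (Fin n) + 1 : ℕ) : ℝ) ≤ 2 * n := by
    rw [Fintype.card_fin]
    push_cast
    linarith
  have h4 := five_sixths_pow_slack_le hn
  have h6 : 0 ≤ (5 / 6 : ℝ) ^ (2 ^ slack n) := by positivity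
  calc _ ≤ 4 * (n : ℝ) ^ 2 * (4 * n * (2 * n * (2 * (1 / (n : ℝ) ^ 16)))) := by gcongr
    _ = 64 / (n : ℝ) ^ 10 * (1 / (n : ℝ) ^ 2) := by
        field_simp
        ring
    _ ≤ 1 * (1 / (n : ℝ) ^ 2) := by
        gcongr
        rw [div_le_one (by positivity)]
        calc (64 : ℝ) ≤ 3 ^ 10 := by norm_num
          _ ≤ (n : ℝ) ^ 10 := by gcongr
    _ = _ := one_mul _

/-- Random labels are good with high probability. -/
theorem frac_not_goodLabels_le {r W : ℕ} (hW : bits n m r ≤ W) (hn : 3 ≤ n)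
    (hmn : m / n + 1 ≤ n) {H : Fin n → Fin n → Prop} {O : Finset (Fin n)}
    (hdeg : ∀ v, (nbrs H v univ).card < 2 ^ degBits n m r)
    {s : Finset (Sym2 (Fin n))} (hs : ∀ e ∈ s, ¬ e.IsDiag) (hsm : s.card ≤ m)
    (hHs : ∀ u v, H u v → s(u, v) ∈ s) :
    frac (fun f : Fin n → Fin W → Bool =>
      ¬ GoodLabels n m r H O fun v => bitLabel W (bits n m r) (f v))
      ≤ 1 / (n : ℝ) ^ 2 + if r = 0 then 2 / (n : ℝ) else 0 := by
  have hn0 : (0 : ℝ) < n := by exact_mod_cast (by omega : 0 < n)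
  by_cases hL : 0 < levels n m r
  swap
  · refine (frac_mono (Q := fun _ => False) fun f hf => hf fun h => absurd h hL).trans ?_
    rw [frac_eq_avg]
    simp only [avg, if_false, sum_const_zero, zero_div]
    positivity
  by_cases hr : r = 0
  · rw [if_pos hr]
    have key : ∀ f : Fin n → Fin W → Bool,
        (¬ GoodLabels n m r H O fun v => bitLabel W (bits n m r) (f v)) →
        (∃ S ∈ relevantSets H O (degBits n m r) (levels n m r),
          ¬ Balanced (2 ^ bits n m r) (2 ^ slack n) (fun v => bitLabel W (bits n m r) (f v)) S) ∨
        n < (s.filter (Monochromatic fun v => bitLabel W (bits n m r) (f v))).card := by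
      intro f hf
      by_contra hcon
      push Not at hcon
      refine hf fun _ => ⟨hcon.1, fun j => ?_⟩
      -- In phase 0 a machine may hold several classes, so its load is bounded by all monochromatic
      -- edges together.
      refine (card_le_card fun e he => ?_).trans (hcon.2.trans (by omega))
      obtain ⟨u, v, rfl, hH, huv, -⟩ := mem_classEdges.1 he
      exact mem_filter.2 ⟨hHs _ _ hH, by simp [Monochromatic, huv]⟩
    refine (frac_mono key).trans ((frac_or_le _ _).trans ?_)
    refine add_le_add (frac_exists_not_balanced_le hW hn hmn hL H O) ?_
    refine frac_monochromatic_gt_le (isUniformLabel_bitLabel hW) (bitLabel_lt W _) s hs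
      (by omega) ?_
    subst hr
    have h1 := two_mul_le_two_pow_bits_zero n m
    have h2 : m < n * (m / n + 1) := Nat.lt_mul_div_succ m (by omega)
    calc 2 * s.card ≤ 2 * (m / n + 1) * n := by nlinarith
      _ ≤ _ := Nat.mul_le_mul_right _ h1
  · rw [if_neg hr, add_zero]
    refine (frac_mono fun f hf => ?_).trans (frac_exists_not_balanced_le hW hn hmn hL H O)
    by_contra hcon
    push Not at hcon
    exact hf fun _ => ⟨hcon, card_classEdges_le hr hn hL (fun v => bitLabel_lt _ _ _) hdeg hcon⟩

end Schedule

/-! ### Words and messages; machine `v % p` is responsible for vertex `v`. -/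

section Encoding

open Finset Classical

variable {n p : ℕ}

/-- The part of the vector `x` that concerns the vertices `v` with `v % p = j`. -/
def pack (p : ℕ) (x : Fin n → ℕ) (j : ℕ) : List ℕ :=
  (List.range (n / p + 1)).map fun l => if h : j + l * p < n then x ⟨j + l * p, h⟩ else 0

@[simp]
theorem length_pack (x : Fin n → ℕ) (j : ℕ) : (pack p x j).length = n / p + 1 := by
  simp [pack]

theorem lt_of_mem_pack {x : Fin n → ℕ} {j B : ℕ} (hB : 0 < B) (hx : ∀ v, x v < B) {w : ℕ}
    (hw : w ∈ pack p x j) : w < B := by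
  obtain ⟨l, -, rfl⟩ := List.mem_map.1 hw
  split_ifs
  · exact hx _
  · exact hB

theorem getD_pack (x : Fin n → ℕ) (v : Fin n) : (pack p x (v % p)).getD (v / p) 0 = x v := by
  have h1 : (v : ℕ) / p < n / p + 1 := Nat.lt_succ_of_le (Nat.div_le_div_right v.2.le)
  have h2 : (v : ℕ) % p + v / p * p = v := Nat.mod_add_div' _ _
  rw [List.getD_eq_getElem?_getD, pack, List.getElem?_map, List.getElem?_range h1]
  simp [h2]

/-- The entry of vertex `w` in a vector of which machine `j` has sent `pack p x j`. -/
def unpack [NeZero p] (inbox : Fin p → List ℕ) (w : ℕ) : ℕ :=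
  (inbox (Fin.ofNat p w)).getD (w / p) 0

theorem unpack_pack [NeZero p] (x : Fin p → Fin n → ℕ) (v : Fin n) :
    unpack (fun j => pack p (x j) j) v = x (Fin.ofNat p v) v := getD_pack _ _

/-- The word that represents vertex `v` when the vertices of `R` have been removed. -/
def vertexWord (R : Finset (Fin n)) (v : Fin n) : ℕ := if v ∈ R then n + v else v

/-- The words that represent the edges in `E` when the vertices of `R` have been removed. -/
def edgeWords (R : Finset (Fin n)) (E : List (Fin n × Fin n)) : List ℕ :=
  E.flatMap fun e => [vertexWord R e.1, vertexWord R e.2]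

theorem vertexWord_lt (R : Finset (Fin n)) (v : Fin n) : vertexWord R v < 2 * n := by
  unfold vertexWord
  split_ifs <;> omega

theorem vertexWord_eq_coe {R : Finset (Fin n)} {v u : Fin n} :
    vertexWord R v = u ↔ v = u ∧ u ∉ R := by
  unfold vertexWord
  split_ifs with h
  · constructor
    · intro h1
      omega
    · rintro ⟨rfl, h1⟩
      exact absurd h h1
  · constructor
    · intro h1
      have := Fin.ext h1
      exact ⟨this, this ▸ h⟩
    · rintro ⟨rfl, -⟩
      rfl

theorem vertexWord_lt_iff {R : Finset (Fin n)} {v : Fin n} : vertexWord R v < n ↔ v ∉ R := by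
  unfold vertexWord
  split_ifs with h
  · simp [h]
  · simp [h]

theorem length_edgeWords (R : Finset (Fin n)) (E : List (Fin n × Fin n)) :
    (edgeWords R E).length = 2 * E.length := by
  simp [edgeWords, List.length_flatMap, mul_comm]

theorem lt_of_mem_edgeWords {R : Finset (Fin n)} {E : List (Fin n × Fin n)} {w : ℕ}
    (hw : w ∈ edgeWords R E) : w < 2 * n := by
  obtain ⟨e, -, he⟩ := List.mem_flatMap.1 hw
  simp only [List.mem_cons, List.not_mem_nil, or_false] at he
  rcases he with rfl | rfl <;> exact vertexWord_lt _ _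

/-- Split a list of words into consecutive pairs. -/
def pairs : List ℕ → List (ℕ × ℕ)
  | x :: y :: l => (x, y) :: pairs l
  | _ => []

theorem pairs_flatMap {α : Type*} (l : List α) (f g : α → ℕ) :
    pairs (l.flatMap fun e => [f e, g e]) = l.map fun e => (f e, g e) := by
  induction l with
  | nil => rfl
  | cons a l ih => simp [pairs, ih]

theorem length_pairs_le : ∀ l : List ℕ, 2 * (pairs l).length ≤ l.length
  | [] => by simp [pairs]
  | [_] => by simp [pairs]
  | _ :: _ :: l => by
    have := length_pairs_le l
    simp only [pairs, List.length_cons]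
    omega

theorem pairs_edgeWords (R : Finset (Fin n)) (E : List (Fin n × Fin n)) :
    pairs (edgeWords R E) = E.map fun e => (vertexWord R e.1, vertexWord R e.2) :=
  pairs_flatMap E (fun e => vertexWord R e.1) fun e => vertexWord R e.2

/-- The graph described by a list of words; words that are at least `n` are ignored. -/
def wordGraph (l : List ℕ) (u v : Fin n) : Prop :=
  ((u : ℕ), (v : ℕ)) ∈ pairs l ∨ ((v : ℕ), (u : ℕ)) ∈ pairs l

theorem wordGraph_edgeWords {R : Finset (Fin n)} {E : List (Fin n × Fin n)} {u v : Fin n} :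
    wordGraph (edgeWords R E) u v ↔ ((u, v) ∈ E ∨ (v, u) ∈ E) ∧ u ∉ R ∧ v ∉ R := by
  have h : ∀ u v : Fin n, ((u : ℕ), (v : ℕ)) ∈ pairs (edgeWords R E) ↔
      (u, v) ∈ E ∧ u ∉ R ∧ v ∉ R := by
    intro u v
    rw [pairs_edgeWords, List.mem_map]
    simp only [Prod.mk.injEq, vertexWord_eq_coe]
    constructor
    · rintro ⟨⟨x, y⟩, he, ⟨rfl, hu⟩, rfl, hv⟩
      exact ⟨he, hu, hv⟩
    · rintro ⟨he, hu, hv⟩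
      exact ⟨(u, v), he, ⟨rfl, hu⟩, rfl, hv⟩
  unfold wordGraph
  rw [h, h]
  tauto

/-- The stored words after removing the vertices that are announced in the messages. -/
def updatedMem (n : ℕ) [NeZero p] (σ : LocalState p) : List ℕ :=
  σ.mem.map fun w => if w < n ∧ unpack σ.inbox w = 1 then n + w else w

theorem updatedMem_eq [NeZero p] {σ : LocalState p} {R : Finset (Fin n)}
    {E : List (Fin n × Fin n)} (h : σ.mem = edgeWords R E) :
    updatedMem n σ
      = edgeWords (R ∪ univ.filter fun v : Fin n => unpack σ.inbox v = 1) E := by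
  have hv : ∀ v : Fin n, (if vertexWord R v < n ∧ unpack σ.inbox (vertexWord R v) = 1
      then n + vertexWord R v else vertexWord R v)
      = vertexWord (R ∪ univ.filter fun v : Fin n => unpack σ.inbox v = 1) v := by
    intro v
    by_cases hR : v ∈ R
    · have h1 : ¬ vertexWord R v < n := fun h => vertexWord_lt_iff.1 h hR
      rw [if_neg fun h => h1 h.1]
      simp [vertexWord, hR]
    · by_cases hb : unpack σ.inbox v = 1 <;> simp [vertexWord, hR, hb]
  rw [updatedMem, h, edgeWords, edgeWords, List.map_flatMap]
  congr 1
  funext e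
  rw [← hv, ← hv]
  rfl

/-- The edges that are sent to machine `j`, given the labels of all vertices. -/
def classMessage (n p : ℕ) (g : ℕ → ℕ) (l : List ℕ) (j : ℕ) : List ℕ :=
  ((pairs l).filter fun e => decide (e.1 < n ∧ e.2 < n ∧ g e.1 = g e.2 ∧ g e.1 % p = j)).flatMap
    fun e => [e.1, e.2]

theorem pairs_classMessage (g : ℕ → ℕ) (l : List ℕ) (j : ℕ) : pairs (classMessage n p g l j)
    = (pairs l).filter fun e => decide (e.1 < n ∧ e.2 < n ∧ g e.1 = g e.2 ∧ g e.1 % p = j) := by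
  rw [classMessage, pairs_flatMap]
  simp

theorem lt_of_mem_classMessage {g : ℕ → ℕ} {l : List ℕ} {j w : ℕ}
    (hw : w ∈ classMessage n p g l j) : w < n := by
  obtain ⟨e, he, hw⟩ := List.mem_flatMap.1 hw
  have := of_decide_eq_true (List.mem_filter.1 he).2
  simp only [List.mem_cons, List.not_mem_nil, or_false] at hw
  rcases hw with rfl | rfl
  · exact this.1
  · exact this.2.1

theorem length_classMessage (g : ℕ → ℕ) (l : List ℕ) (j : ℕ) : (classMessage n p g l j).length
    = 2 * (pairs l).countP
      fun e => decide (e.1 < n ∧ e.2 < n ∧ g e.1 = g e.2 ∧ g e.1 % p = j) := by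
  simp [classMessage, List.length_flatMap, List.countP_eq_length_filter, mul_comm]

theorem sum_length_classMessage_le (g : ℕ → ℕ) (l : List ℕ) :
    ∑ j : Fin p, (classMessage n p g l j).length ≤ l.length := by
  have h : ∀ l : List (ℕ × ℕ), ∑ j : Fin p, (l.countP
      fun e => decide (e.1 < n ∧ e.2 < n ∧ g e.1 = g e.2 ∧ g e.1 % p = j)) ≤ l.length := by
    intro l
    induction l with
    | nil => simp
    | cons e l ih =>
      simp only [List.countP_cons, sum_add_distrib, List.length_cons]
      refine add_le_add ih ?_
      -- A stored pair is sent to at most one machine, the one determined by its common label.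
      rw [← card_filter, card_le_one]
      intro i hi j hj
      have hi := of_decide_eq_true (mem_filter.1 hi).2
      have hj := of_decide_eq_true (mem_filter.1 hj).2
      exact Fin.ext (hi.2.2.2.symm.trans hj.2.2.2)
  simp only [length_classMessage, ← mul_sum]
  exact (Nat.mul_le_mul_left 2 (h _)).trans (length_pairs_le l)

theorem wordGraph_classMessage {g : ℕ → ℕ} {l : List ℕ} {j : ℕ} {u v : Fin n} :
    wordGraph (classMessage n p g l j) u v ↔ wordGraph l u v ∧ g v = g u ∧ g u % p = j := by
  simp only [wordGraph, pairs_classMessage, List.mem_filter, decide_eq_true_eq, Fin.is_lt,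
    true_and]
  constructor
  · rintro (⟨h1, h2, h3⟩ | ⟨h1, h2, h3⟩)
    · exact ⟨Or.inl h1, h2.symm, h3⟩
    · exact ⟨Or.inr h1, h2, h2 ▸ h3⟩
  · rintro ⟨h1 | h1, h2, h3⟩
    · exact Or.inl ⟨h1, h2.symm, h3⟩
    · exact Or.inr ⟨h1, h2, h2.symm ▸ h3⟩

/-- For the vertices `v` with `v % p` equal to the number of the machine: whether the sum of the
received entries is at least `τ`. -/
def tally (n τ : ℕ) (inbox : Fin p → List ℕ) (v : Fin n) : ℕ :=
  if τ ≤ ∑ i, (inbox i).getD (v / p) 0 then 1 else 0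

theorem tally_le_one (τ : ℕ) (inbox : Fin p → List ℕ) (v : Fin n) : tally n τ inbox v ≤ 1 := by
  unfold tally
  split_ifs <;> simp

/-- With 0/1 entries and τ = 1 this computes a disjunction over the machines; with local degrees it
tests the global degree. -/
theorem unpack_tally [NeZero p] (τ : ℕ) (x : Fin p → Fin n → ℕ) (v : Fin n) :
    unpack (fun j : Fin p => pack p (tally n τ fun i => pack p (x i) j) j) v
      = if τ ≤ ∑ i, x i v then 1 else 0 := by
  rw [unpack_pack (fun j : Fin p => tally n τ fun i => pack p (x i) j), tally]
  simp only [Fin.val_ofNat, getD_pack]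

end Encoding

/-! ### The algorithm and its message sizes. -/

section Algorithm

open Finset Classical

/-- An upper bound for the number of label bits in all phases. -/
def maxBits (n m : ℕ) : ℕ := Nat.clog 2 (m / n + 1) + Nat.log 2 n + 1

theorem bits_le_maxBits (n m r : ℕ) : bits n m r ≤ maxBits n m := by
  have := degBits_le n m r
  unfold bits labelBits maxBits
  split_ifs <;> omega

/-- The label of a vertex in phase `r`, obtained from the coins of its machine. -/
def coinLabel (n m r : ℕ) (c : Fin (n * maxBits n m) → Bool) (v : Fin n) : ℕ :=
  bitLabel (maxBits n m) (bits n m r) fun b => c (finProdFinEquiv (v, b))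

/-- The local computations. In each phase of six rounds every vertex gets a random label, the edges
with equal labels at both ends are collected on the machine of that label, where several steps of
peeling are carried out, the peeled vertices are announced, the degrees of the remaining
vertices are computed, and the vertices of large degree are announced. -/
noncomputable def localStep (n m t : ℕ) (i : Fin (m / n + 1))
    (c : Fin (n * maxBits n m) → Bool) (σ : LocalState (m / n + 1)) :
    List ℕ × (Fin (m / n + 1) → List ℕ) :=
  match t % 6 with
  | 0 => (updatedMem n σ, fun _ => pack (m / n + 1) (coinLabel n m (t / 6) c) i)
  | 1 => (σ.mem, fun j =>
      if 0 < levels n m (t / 6) then classMessage n (m / n + 1) (unpack σ.inbox) σ.mem j else [])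
  | 2 => (σ.mem, fun j => pack (m / n + 1) (fun v : Fin n =>
      if v ∈ peel (fun u w => ∃ j, wordGraph (σ.inbox j) u w)
        (threshold (degBits n m (t / 6)) (bits n m (t / 6))) (levels n m (t / 6)) then 1 else 0) j)
  | 3 => (σ.mem, fun _ => pack (m / n + 1) (tally n 1 σ.inbox) i)
  | 4 => (updatedMem n σ, fun j => pack (m / n + 1)
      (fun v : Fin n => (nbrs (wordGraph (updatedMem n σ)) v univ).card) j)
  | _ => (σ.mem, fun _ => pack (m / n + 1)
      (tally n (2 ^ (degBits n m (t / 6) - levels n m (t / 6) - 1)) σ.inbox) i)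

/-- The algorithm for initial distributions with at most `K * (m / p + 1)` edges per machine. -/
noncomputable def vertexCoverAlgorithm (K n m : ℕ) : Algorithm n where
  machines := m / n + 1
  machines_pos := Nat.succ_pos _
  memory := (8 * K + 10) * n
  wordBits := Nat.log 2 n + 4
  rounds := 6 * phases n
  coins := n * maxBits n m
  step t := localStep n m t
  output _ σ := univ.filter fun v : Fin n => n + (v : ℕ) ∈ updatedMem n σ

variable {n m : ℕ}

/-- Whatever is received, the kept words encode the same edges; only the removal marks change. -/
theorem exists_localStep_fst_eq {t : ℕ} {i : Fin (m / n + 1)} {c : Fin (n * maxBits n m) → Bool}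
    {σ : LocalState (m / n + 1)} {R : Finset (Fin n)} {E : List (Fin n × Fin n)}
    (h : σ.mem = edgeWords R E) : ∃ Q, (localStep n m t i c σ).1 = edgeWords Q E := by
  unfold localStep
  split
  · exact ⟨_, updatedMem_eq h⟩
  · exact ⟨_, h⟩
  · exact ⟨_, h⟩
  · exact ⟨_, h⟩
  · exact ⟨_, updatedMem_eq h⟩
  · exact ⟨_, h⟩

theorem length_localStep_fst (t : ℕ) (i : Fin (m / n + 1)) (c : Fin (n * maxBits n m) → Bool)
    (σ : LocalState (m / n + 1)) : (localStep n m t i c σ).1.length = σ.mem.length := by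
  unfold localStep
  split <;> simp [updatedMem]

theorem length_localStep_snd {t : ℕ} (ht : t % 6 ≠ 1) (i : Fin (m / n + 1))
    (c : Fin (n * maxBits n m) → Bool) (σ : LocalState (m / n + 1)) (j : Fin (m / n + 1)) :
    ((localStep n m t i c σ).2 j).length = n / (m / n + 1) + 1 := by
  unfold localStep
  split <;> dsimp only
  · exact length_pack _ _
  · contradiction
  all_goals exact length_pack _ _

theorem sum_length_localStep_snd_le (hmn : m / n + 1 ≤ n) (t : ℕ) (i : Fin (m / n + 1))
    (c : Fin (n * maxBits n m) → Bool) (σ : LocalState (m / n + 1)) :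
    ∑ j, ((localStep n m t i c σ).2 j).length ≤ max σ.mem.length (2 * n) := by
  by_cases ht : t % 6 = 1
  · refine le_trans ?_ (le_max_left _ _)
    unfold localStep
    simp only [ht]
    split_ifs
    · exact sum_length_classMessage_le _ _
    · simp
  · refine le_trans ?_ (le_max_right _ _)
    simp only [length_localStep_snd ht]
    rw [sum_const, card_univ, Fintype.card_fin, smul_eq_mul, mul_add, mul_one]
    -- With p machines, p(n/p + 1) ≤ n + p ≤ 2n.
    have := Nat.mul_div_le n (m / n + 1)
    omega

theorem lt_of_mem_localStep_snd {B : ℕ} (hn : n < B) (hB : ∀ r, 2 ^ bits n m r ≤ B) {t : ℕ}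
    {i : Fin (m / n + 1)} {c : Fin (n * maxBits n m) → Bool} {σ : LocalState (m / n + 1)}
    {j : Fin (m / n + 1)} {w : ℕ} (hw : w ∈ (localStep n m t i c σ).2 j) : w < B := by
  have hB0 : 0 < B := by omega
  unfold localStep at hw
  split at hw <;> dsimp only at hw
  · exact lt_of_mem_pack hB0 (fun v => (bitLabel_lt _ _ _).trans_le (hB _)) hw
  · split_ifs at hw
    · exact (lt_of_mem_classMessage hw).trans hn
    · simp at hw
  · refine lt_of_mem_pack hB0 (fun v => ?_) hw
    have := v.2
    split_ifs <;> omega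
  · refine lt_of_mem_pack hB0 (fun v => ?_) hw
    have := v.2
    have := tally_le_one 1 σ.inbox v
    omega
  · refine lt_of_mem_pack hB0 (fun v => ?_) hw
    have : (nbrs (wordGraph (updatedMem n σ)) v univ).card ≤ n := by
      simpa using card_le_univ (nbrs (wordGraph (updatedMem n σ)) v univ)
    omega
  · refine lt_of_mem_pack hB0 (fun v => ?_) hw
    have := v.2
    have := tally_le_one (2 ^ (degBits n m (t / 6) - levels n m (t / 6) - 1)) σ.inbox v
    omega

end Algorithm

/-! ### The execution realizes the abstract peeling process. -/

section Simulation

open Finset Classical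

variable {n m : ℕ}

/-- The vertices removed before phase `r`, for given labels `g`. -/
noncomputable def removed (n m : ℕ) (G : Fin n → Fin n → Prop) (g : ℕ → Fin n → ℕ) :
    ℕ → Finset (Fin n)
  | 0 => ∅
  | r + 1 =>
    (removed n m G g r ∪ peeled (alive G (removed n m G g r)) (g r) (m / n + 1)
      (threshold (degBits n m r) (bits n m r)) (levels n m r)) ∪
    heavy G (removed n m G g r ∪ peeled (alive G (removed n m G g r)) (g r) (m / n + 1)
      (threshold (degBits n m r) (bits n m r)) (levels n m r))
      (2 ^ (degBits n m r - levels n m r - 1))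

/-- The vertices removed before the degrees are computed in phase `r`. -/
noncomputable def halfRemoved (n m : ℕ) (G : Fin n → Fin n → Prop) (g : ℕ → Fin n → ℕ) (r : ℕ) :
    Finset (Fin n) :=
  removed n m G g r ∪ peeled (alive G (removed n m G g r)) (g r) (m / n + 1)
    (threshold (degBits n m r) (bits n m r)) (levels n m r)

theorem removed_succ (G : Fin n → Fin n → Prop) (g : ℕ → Fin n → ℕ) (r : ℕ) :
    removed n m G g (r + 1) = halfRemoved n m G g r ∪
      heavy G (halfRemoved n m G g r) (2 ^ (degBits n m r - levels n m r - 1)) := rfl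

/-- The execution of `vertexCoverAlgorithm` for given coins. -/
noncomputable def run (n m : ℕ) (E : Fin (m / n + 1) → List (Fin n × Fin n))
    (c : ℕ → Fin (m / n + 1) → Fin (n * maxBits n m) → Bool) :
    ℕ → Fin (m / n + 1) → LocalState (m / n + 1)
  | 0 => fun i =>
    { mem := (E i).flatMap fun e => [(e.1 : ℕ), (e.2 : ℕ)]
      inbox := fun _ => [] }
  | t + 1 => fun i =>
    { mem := (localStep n m t i (c t i) (run n m E c t i)).1
      inbox := fun j => (localStep n m t j (c t j) (run n m E c t j)).2 i }

/-- The labels drawn in phase `r`. -/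
def drawnLabels (n m : ℕ) (c : ℕ → Fin (m / n + 1) → Fin (n * maxBits n m) → Bool) (r : ℕ)
    (v : Fin n) : ℕ :=
  coinLabel n m r (c (6 * r) (Fin.ofNat _ v)) v

/-- Every edge of `G` is stored on exactly one machine, and nothing else is stored. -/
def SplitsEdges {p : ℕ} (E : Fin p → List (Fin n × Fin n)) (G : Fin n → Fin n → Prop) : Prop :=
  ∀ u v, (∀ i, (u, v) ∈ E i ∨ (v, u) ∈ E i → G u v) ∧
    (G u v → ∃! i, (u, v) ∈ E i ∨ (v, u) ∈ E i)

variable {E : Fin (m / n + 1) → List (Fin n × Fin n)}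
  {c : ℕ → Fin (m / n + 1) → Fin (n * maxBits n m) → Bool} {G : Fin n → Fin n → Prop}

theorem edgeWords_empty (E : List (Fin n × Fin n)) :
    edgeWords ∅ E = E.flatMap fun e => [(e.1 : ℕ), (e.2 : ℕ)] := by
  simp [edgeWords, vertexWord]

theorem exists_mem_run_eq (t : ℕ) (i : Fin (m / n + 1)) :
    ∃ Q, (run n m E c t i).mem = edgeWords Q (E i) := by
  induction t with
  | zero => exact ⟨∅, (edgeWords_empty _).symm⟩
  | succ t ih =>
    obtain ⟨R, hR⟩ := ih
    exact exists_localStep_fst_eq hR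

/-- Each edge is stored on one machine only, so the local neighbourhoods of `v` are disjoint and the
degrees add up exactly. -/
theorem sum_card_nbrs_wordGraph {p : ℕ} {E : Fin p → List (Fin n × Fin n)}
    (hE : SplitsEdges E G) (R : Finset (Fin n)) (v : Fin n) :
    ∑ i, (nbrs (wordGraph (edgeWords R (E i))) v univ).card
      = (nbrs (alive G R) v univ).card := by
  rw [← card_biUnion]
  · congr 1
    ext u
    simp only [mem_biUnion, mem_univ, true_and, mem_nbrs, wordGraph_edgeWords, alive]
    constructor
    · rintro ⟨i, h, hR⟩
      exact ⟨(hE v u).1 i h, hR⟩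
    · rintro ⟨h, hR⟩
      obtain ⟨i, hi, -⟩ := (hE v u).2 h
      exact ⟨i, hi, hR⟩
  · intro i _ j _ hij
    refine disjoint_left.2 fun u hui huj => hij ?_
    have hi := wordGraph_edgeWords.1 (mem_nbrs.1 hui).2
    have hj := wordGraph_edgeWords.1 (mem_nbrs.1 huj).2
    exact ((hE v u).2 ((hE v u).1 i hi.1)).unique hi.1 hj.1

theorem wordGraph_messages {p : ℕ} {E : Fin p → List (Fin n × Fin n)} (hE : SplitsEdges E G)
    (R : Finset (Fin n)) (g : Fin p → ℕ → ℕ) (f : Fin n → ℕ) (hg : ∀ i, ∀ v : Fin n, g i v = f v)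
    (j : ℕ) : (fun u w => ∃ i, wordGraph (classMessage n p (g i) (edgeWords R (E i)) j) u w)
      = classGraph (alive G R) f p j := by
  funext u w
  simp only [wordGraph_classMessage, wordGraph_edgeWords, hg, classGraph, alive, eq_iff_iff]
  constructor
  · rintro ⟨i, ⟨h1, h2⟩, h3⟩
    exact ⟨⟨(hE u w).1 i h1, h2⟩, h3⟩
  · rintro ⟨⟨h1, h2⟩, h3⟩
    obtain ⟨i, hi, -⟩ := (hE u w).2 h1
    exact ⟨i, ⟨hi, h2⟩, h3⟩

section Rounds

variable (r : ℕ)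

/-- The invariant at the start of a phase concerns `updatedMem` rather than `mem`: the last
announcements of the previous phase are still in the inboxes. -/
theorem run_draw {R : Finset (Fin n)}
    (h : ∀ i, updatedMem n (run n m E c (6 * r) i) = edgeWords R (E i)) (i : Fin (m / n + 1)) :
    run n m E c (6 * r + 1) i = ⟨edgeWords R (E i),
      fun j => pack (m / n + 1) (coinLabel n m r (c (6 * r) j)) j⟩ := by
  have h1 : 6 * r % 6 = 0 := by omega
  have h2 : 6 * r / 6 = r := by omega
  simp only [run, localStep, h1, h2, h]

theorem run_collect {R : Finset (Fin n)}
    (h : ∀ i, updatedMem n (run n m E c (6 * r) i) = edgeWords R (E i)) (i : Fin (m / n + 1)) :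
    run n m E c (6 * r + 2) i = ⟨edgeWords R (E i), fun j =>
      if 0 < levels n m r then classMessage n (m / n + 1)
        (unpack (run n m E c (6 * r + 1) j).inbox) (edgeWords R (E j)) i else []⟩ := by
  have h1 : (6 * r + 1) % 6 = 1 := by omega
  have h2 : (6 * r + 1) / 6 = r := by omega
  have h3 : ∀ i, (run n m E c (6 * r + 1) i).mem = edgeWords R (E i) := fun i => by
    rw [run_draw r h]
  rw [run]
  simp only [localStep, h1, h2, h3]

theorem unpack_run_draw {R : Finset (Fin n)}
    (h : ∀ i, updatedMem n (run n m E c (6 * r) i) = edgeWords R (E i)) (i : Fin (m / n + 1))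
    (v : Fin n) : unpack (run n m E c (6 * r + 1) i).inbox v = drawnLabels n m c r v := by
  rw [run_draw r h]
  exact unpack_pack (fun j => coinLabel n m r (c (6 * r) j)) v

theorem run_peel (hE : SplitsEdges E G) {R : Finset (Fin n)}
    (h : ∀ i, updatedMem n (run n m E c (6 * r) i) = edgeWords R (E i)) (i : Fin (m / n + 1)) :
    run n m E c (6 * r + 3) i = ⟨edgeWords R (E i), fun j => pack (m / n + 1) (fun v : Fin n =>
      if v ∈ peel (classGraph (alive G R) (drawnLabels n m c r) (m / n + 1) j)
        (threshold (degBits n m r) (bits n m r)) (levels n m r) then 1 else 0) i⟩ := by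
  have h1 : (6 * r + 2) % 6 = 2 := by omega
  have h2 : (6 * r + 2) / 6 = r := by omega
  rw [run]
  simp only [localStep, h1, h2, run_collect r h]
  congr 1
  funext j
  congr 1
  funext v
  by_cases hL : 0 < levels n m r
  · simp only [if_pos hL]
    rw [wordGraph_messages hE R _ (drawnLabels n m c r) (fun i v => unpack_run_draw r h i v)]
  -- Without levels no edges are sent, and peeling for zero steps removes nothing.
  · rw [Nat.eq_zero_of_not_pos hL]
    simp [peel]

theorem run_announce (hE : SplitsEdges E G) {R : Finset (Fin n)}
    (h : ∀ i, updatedMem n (run n m E c (6 * r) i) = edgeWords R (E i)) (i : Fin (m / n + 1)) :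
    updatedMem n (run n m E c (6 * r + 4) i) = edgeWords (R ∪ peeled (alive G R)
      (drawnLabels n m c r) (m / n + 1) (threshold (degBits n m r) (bits n m r)) (levels n m r))
      (E i) := by
  have h1 : (6 * r + 3) % 6 = 3 := by omega
  have h3 : run n m E c (6 * r + 4) i = ⟨edgeWords R (E i), fun j =>
      pack (m / n + 1) (tally n 1 (run n m E c (6 * r + 3) j).inbox) j⟩ := by
    rw [run]
    simp only [localStep, h1]
    rw [run_peel r hE h]
  rw [h3, updatedMem_eq (R := R) (E := E i) rfl]
  congr 2
  ext v
  simp only [mem_filter, mem_univ, true_and, run_peel r hE h]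
  rw [unpack_tally 1 (fun (j : Fin (m / n + 1)) (v : Fin n) =>
    if v ∈ peel (classGraph (alive G R) (drawnLabels n m c r) (m / n + 1) j)
        (threshold (degBits n m r) (bits n m r)) (levels n m r) then 1 else 0) v]
  simp only [ite_eq_left_iff, zero_ne_one, imp_false, not_not, peeled, mem_filter, mem_univ,
    true_and, sum_boole, Nat.one_le_iff_ne_zero, Nat.cast_id, ne_eq, card_eq_zero,
    filter_eq_empty_iff, not_forall, exists_prop]

theorem run_degrees (hE : SplitsEdges E G) {R : Finset (Fin n)}
    (h : ∀ i, updatedMem n (run n m E c (6 * r) i) = edgeWords R (E i)) {Q : Finset (Fin n)}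
    (hQ : Q = R ∪ peeled (alive G R)
      (drawnLabels n m c r) (m / n + 1) (threshold (degBits n m r) (bits n m r)) (levels n m r))
    (i : Fin (m / n + 1)) :
    updatedMem n (run n m E c (6 * (r + 1)) i)
      = edgeWords (Q ∪ heavy G Q (2 ^ (degBits n m r - levels n m r - 1))) (E i) := by
  have h1 : (6 * r + 4) % 6 = 4 := by omega
  have h2 : (6 * r + 5) % 6 = 5 := by omega
  have h2' : (6 * r + 5) / 6 = r := by omega
  have h3 : ∀ i, run n m E c (6 * r + 5) i = ⟨edgeWords Q (E i), fun j =>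
      pack (m / n + 1) (fun v : Fin n => (nbrs (wordGraph (edgeWords Q (E j))) v univ).card) i⟩ := by
    intro i
    rw [run]
    simp only [localStep, h1, run_announce r hE h, hQ]
  have h4 : run n m E c (6 * (r + 1)) i = ⟨edgeWords Q (E i), fun j =>
      pack (m / n + 1) (tally n (2 ^ (degBits n m r - levels n m r - 1)) fun i =>
        pack (m / n + 1)
          (fun v : Fin n => (nbrs (wordGraph (edgeWords Q (E i))) v univ).card) j) j⟩ := by
    rw [show 6 * (r + 1) = 6 * r + 5 + 1 by ring, run]
    simp only [localStep, h2, h2', h3]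
  rw [h4, updatedMem_eq (R := Q) (E := E i) rfl]
  congr 2
  ext v
  simp only [mem_filter, mem_univ, true_and]
  rw [unpack_tally (2 ^ (degBits n m r - levels n m r - 1))
    (fun (i : Fin (m / n + 1)) (v : Fin n) => (nbrs (wordGraph (edgeWords Q (E i))) v univ).card) v,
    sum_card_nbrs_wordGraph hE]
  simp [heavy]

end Rounds

theorem updatedMem_run (hE : SplitsEdges E G) (r : ℕ) (i : Fin (m / n + 1)) :
    updatedMem n (run n m E c (6 * r) i)
      = edgeWords (removed n m G (drawnLabels n m c) r) (E i) := by
  induction r generalizing i with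
  | zero =>
    rw [updatedMem_eq (R := ∅) (E := E i) (edgeWords_empty _).symm]
    congr 1
    -- Empty inboxes are read as the default 0, which announces no removal.
    simp [removed, run, unpack]
  | succ r ih => exact run_degrees r hE ih rfl i

end Simulation

/-! ### Memory bounds and approximation ratio under good labels. -/

section Analysis

open Finset Classical

variable {n m K : ℕ} {E : Fin (m / n + 1) → List (Fin n × Fin n)}
  {c : ℕ → Fin (m / n + 1) → Fin (n * maxBits n m) → Bool}

theorem splitsEdges_of_sum_eq {p : ℕ} {E : Fin p → List (Fin n × Fin n)} {G : SimpleGraph (Fin n)}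
    [DecidableRel G.Adj]
    (h : ∑ i, ((E i : Multiset (Fin n × Fin n)).map fun e => s(e.1, e.2)) = G.edgeFinset.val) :
    SplitsEdges E G.Adj := by
  have hmem : ∀ u v i, ((u, v) ∈ E i ∨ (v, u) ∈ E i) ↔
      s(u, v) ∈ (E i : Multiset (Fin n × Fin n)).map fun e => s(e.1, e.2) := by
    intro u v i
    simp only [Multiset.mem_map, Multiset.mem_coe, Sym2.eq_iff, Prod.exists]
    constructor
    · rintro (h | h)
      · exact ⟨u, v, h, Or.inl ⟨rfl, rfl⟩⟩
      · exact ⟨v, u, h, Or.inr ⟨rfl, rfl⟩⟩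
    · rintro ⟨x, y, h, ⟨rfl, rfl⟩ | ⟨rfl, rfl⟩⟩
      · exact Or.inl h
      · exact Or.inr h
  have hG : ∀ u v, G.Adj u v ↔ ∃ i, (u, v) ∈ E i ∨ (v, u) ∈ E i := by
    intro u v
    have h1 : G.Adj u v ↔ s(u, v) ∈ G.edgeFinset.val := by simp
    rw [h1, ← h, Multiset.mem_sum]
    simp only [mem_univ, true_and, hmem]
  intro u v
  refine ⟨fun i hi => (hG u v).2 ⟨i, hi⟩, fun huv => ?_⟩
  obtain ⟨i, hi⟩ := (hG u v).1 huv
  refine ⟨i, hi, fun j hj => ?_⟩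
  by_contra hij
  rw [hmem, ← Multiset.count_pos] at hi hj
  -- An edge stored on two machines would be counted twice in the sum.
  have h1 : Multiset.count s(u, v) G.edgeFinset.val ≤ 1 :=
    Multiset.nodup_iff_count_le_one.1 G.edgeFinset.nodup _
  rw [← h, Multiset.count_sum'] at h1
  have h2 := sum_le_sum_of_subset (f := fun i => Multiset.count s(u, v)
    ((E i : Multiset (Fin n × Fin n)).map fun e => s(e.1, e.2))) (subset_univ {i, j})
  rw [sum_pair (Ne.symm hij)] at h2
  omega

/-- Each edge is received at most once because the placement sums to a multiset without repetitions;
an edge takes two words. -/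
theorem sum_length_classMessage_le_card {p : ℕ} {E : Fin p → List (Fin n × Fin n)}
    {G : SimpleGraph (Fin n)} [DecidableRel G.Adj]
    (h : ∑ i, ((E i : Multiset (Fin n × Fin n)).map fun e => s(e.1, e.2)) = G.edgeFinset.val)
    (R : Finset (Fin n)) (g : Fin p → ℕ → ℕ) (f : Fin n → ℕ) (hg : ∀ i, ∀ v : Fin n, g i v = f v)
    (j : ℕ) : ∑ i, (classMessage n p (g i) (edgeWords R (E i)) j).length
      ≤ 2 * (classEdges (alive G.Adj R) f p j).card := by
  simp only [length_classMessage, ← mul_sum]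
  refine Nat.mul_le_mul_left 2 ?_
  have hadj := splitsEdges_of_sum_eq h
  calc _ ≤ ∑ i, Multiset.countP (· ∈ classEdges (alive G.Adj R) f p j)
        ((E i : Multiset (Fin n × Fin n)).map fun e => s(e.1, e.2)) := by
        refine sum_le_sum fun i _ => ?_
        rw [pairs_edgeWords, List.countP_map, Multiset.map_coe, Multiset.coe_countP,
          List.countP_map]
        refine List.countP_mono_left fun e he hp => ?_
        simp only [Function.comp, decide_eq_true_eq] at hp ⊢
        obtain ⟨h1, h2, h3, h4⟩ := hp
        have h1 := vertexWord_lt_iff.1 h1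
        have h2 := vertexWord_lt_iff.1 h2
        rw [vertexWord, vertexWord, if_neg h1, if_neg h2, hg, hg] at h3
        rw [vertexWord, if_neg h1, hg] at h4
        exact mem_classEdges.2 ⟨e.1, e.2, rfl, ⟨(hadj e.1 e.2).1 i (Or.inl he), h1, h2⟩,
          h3.symm, h4⟩
    _ = Multiset.countP (· ∈ classEdges (alive G.Adj R) f p j) G.edgeFinset.val := by
        rw [← h]
        exact (map_sum (Multiset.countPAddMonoidHom (· ∈ classEdges (alive G.Adj R) f p j))
          (fun i => (E i : Multiset (Fin n × Fin n)).map fun e => s(e.1, e.2)) univ).symm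
    _ ≤ (classEdges (alive G.Adj R) f p j).card := by
        rw [Multiset.countP_eq_card_filter, ← filter_val, card_val]
        exact card_le_card fun e he => (mem_filter.1 he).2

theorem card_nbrs_removed_lt (G : Fin n → Fin n → Prop) (g : ℕ → Fin n → ℕ) (r : ℕ) (v : Fin n) :
    (nbrs (alive G (removed n m G g r)) v univ).card < 2 ^ degBits n m r := by
  cases r with
  | zero =>
    refine lt_of_le_of_lt (card_le_univ _) ?_
    rw [Fintype.card_fin]
    exact Nat.lt_pow_succ_log_self (by norm_num) _
  | succ r =>
    rw [removed_succ, degBits_succ]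
    exact card_nbrs_alive_union_heavy_lt _ _ (by positivity) v

/-- Phase i costs 8(`levels n m i` + 1)|O|; the levels of all phases together number at most log n +
1. -/
theorem card_removed_sdiff_le {G : Fin n → Fin n → Prop} (hsymm : ∀ u v, G u v → G v u)
    {g : ℕ → Fin n → ℕ} {O : Finset (Fin n)} (hO : ∀ u v, G u v → u ∈ O ∨ v ∈ O)
    (hg : ∀ r v, g r v < 2 ^ bits n m r) :
    ∀ r, (∀ i < r, GoodLabels n m i (alive G (removed n m G g i)) O (g i)) →
      (removed n m G g r \ O).card ≤ 8 * (∑ i ∈ range r, levels n m i + r) * O.card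
  | 0 => by simp [removed]
  | r + 1 => by
    intro hgood
    have ih := card_removed_sdiff_le hsymm hO hg r fun i hi => hgood i (by omega)
    have hr := hgood r (by omega)
    have h1 := card_phase_sdiff_le (R := removed n m G g r) (g := g r) (p := m / n + 1) hsymm
      (Nat.succ_pos _) (levels_le n m r) hO (hg r) (card_nbrs_removed_lt G g r)
      (fun l hl => threshold_of_lt_levels hl)
      (fun l hl v => by
        have hb := (hr (by omega)).1
        refine ⟨hb _ ?_, hb _ ?_⟩
        · simp only [relevantSets, mem_union, mem_image, mem_product, mem_range]
          exact Or.inl (Or.inl (Or.inl ⟨(l, v), ⟨hl, mem_univ _⟩, rfl⟩))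
        · simp only [relevantSets, mem_union, mem_image, mem_product, mem_range]
          exact Or.inl (Or.inl (Or.inr ⟨(l, v), ⟨hl, mem_univ _⟩, rfl⟩))) rfl
    rw [removed_succ, sum_range_succ]
    refine h1.trans ?_
    nlinarith

/-- All labels that are drawn are good. -/
def GoodRun (n m : ℕ) (G : Fin n → Fin n → Prop) (O : Finset (Fin n)) (g : ℕ → Fin n → ℕ) : Prop :=
  ∀ r < phases n, GoodLabels n m r (alive G (removed n m G g r)) O (g r)

theorem drawnLabels_lt (r : ℕ) (v : Fin n) : drawnLabels n m c r v < 2 ^ bits n m r :=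
  bitLabel_lt _ _ _

theorem two_pow_bits_le_two_pow (hn : 3 ≤ n) (hmn : m / n + 1 ≤ n) (r : ℕ) :
    2 ^ bits n m r ≤ 2 ^ (Nat.log 2 n + 4) := by
  by_cases hr : r = 0
  · subst hr
    have h1 : n < 2 ^ (Nat.log 2 n + 1) := Nat.lt_pow_succ_log_self (by norm_num) _
    have h2 : 2 ^ (Nat.log 2 n + 4) = 2 ^ (Nat.log 2 n + 1) * 8 := by
      rw [show Nat.log 2 n + 4 = Nat.log 2 n + 1 + 3 by ring, pow_add _ _ 3]
      norm_num
    have := two_pow_bits_zero_le n m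
    omega
  · refine Nat.pow_le_pow_right (by norm_num) ?_
    have h3 : bits n m r = (degBits n m r + 1) / 2 := by simp [bits, labelBits, hr]
    have := degBits_le n m r
    omega

theorem two_mul_lt_two_pow (n : ℕ) : 2 * n < 2 ^ (Nat.log 2 n + 4) := by
  have h1 : n < 2 ^ (Nat.log 2 n + 1) := Nat.lt_pow_succ_log_self (by norm_num) _
  have h2 : 2 ^ (Nat.log 2 n + 4) = 2 ^ (Nat.log 2 n + 1) * 8 := by
    rw [show Nat.log 2 n + 4 = Nat.log 2 n + 1 + 3 by ring, pow_add _ _ 3]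
    norm_num
  omega

theorem length_mem_run_le (hn : 3 ≤ n) (hlen : ∀ i, (E i).length ≤ K * (m / (m / n + 1) + 1))
    (t : ℕ) (i : Fin (m / n + 1)) : (run n m E c t i).mem.length ≤ 2 * (K * n) := by
  obtain ⟨Q, hQ⟩ := exists_mem_run_eq (E := E) (c := c) t i
  rw [hQ, length_edgeWords]
  refine Nat.mul_le_mul_left 2 ((hlen i).trans (Nat.mul_le_mul_left K ?_))
  have h1 : m < n * (m / n + 1) := Nat.lt_mul_div_succ m (by omega)
  exact (Nat.div_lt_iff_lt_mul (Nat.succ_pos _)).2 h1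

theorem sum_length_inbox_run_le {G : SimpleGraph (Fin n)} [DecidableRel G.Adj] (hn : 3 ≤ n)
    (hmn : m / n + 1 ≤ n) {O : Finset (Fin n)}
    (h : ∑ i, ((E i : Multiset (Fin n × Fin n)).map fun e => s(e.1, e.2)) = G.edgeFinset.val)
    (hgood : GoodRun n m G.Adj O (drawnLabels n m c)) {t : ℕ} (ht : t ≤ 6 * phases n)
    (i : Fin (m / n + 1)) : ∑ j, ((run n m E c t i).inbox j).length ≤ 8 * n := by
  cases t with
  | zero => simp [run]
  | succ t =>
    by_cases h1 : t % 6 = 1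
    · obtain ⟨r, rfl⟩ : ∃ r, t = 6 * r + 1 := ⟨t / 6, by omega⟩
      have hE := splitsEdges_of_sum_eq h
      have hup := updatedMem_run (c := c) hE r
      rw [run_collect r hup]
      -- `GoodLabels` promises nothing for phases without levels, which is why those phases send no
      -- edges.
      by_cases hL : 0 < levels n m r
      · simp only [if_pos hL]
        refine (sum_length_classMessage_le_card h _ _ (drawnLabels n m c r)
          (fun j v => unpack_run_draw r hup j v) i).trans ?_
        have := (hgood r (by omega) hL).2 i
        omega
      · simp [hL]
    · simp only [run, length_localStep_snd h1]
      rw [sum_const, card_univ, Fintype.card_fin, smul_eq_mul, mul_add, mul_one]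
      have := Nat.mul_div_le n (m / n + 1)
      omega

theorem wordsBelow_run (hn : 3 ≤ n) (hmn : m / n + 1 ≤ n) (t : ℕ) (i : Fin (m / n + 1)) :
    (run n m E c t i).WordsBelow (Nat.log 2 n + 4) := by
  constructor
  · intro w hw
    obtain ⟨Q, hQ⟩ := exists_mem_run_eq (E := E) (c := c) t i
    rw [hQ] at hw
    exact (lt_of_mem_edgeWords hw).trans (two_mul_lt_two_pow n)
  · intro j w hw
    cases t with
    | zero => simp [run] at hw
    | succ t =>
      exact lt_of_mem_localStep_snd (by have := two_mul_lt_two_pow n; omega)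
        (two_pow_bits_le_two_pow hn hmn) hw

/-- The coins of all rounds, extended by arbitrary values. -/
def extendCoins (n m : ℕ)
    (ω : Fin (6 * phases n) → Fin (m / n + 1) → Fin (n * maxBits n m) → Bool) (t : ℕ)
    (i : Fin (m / n + 1)) : Fin (n * maxBits n m) → Bool :=
  if h : t < 6 * phases n then ω ⟨t, h⟩ i else fun _ => false

theorem states_eq_run (E : (vertexCoverAlgorithm K n m).Placement)
    (ω : (vertexCoverAlgorithm K n m).Coins) :
    ∀ t ≤ 6 * phases n, (vertexCoverAlgorithm K n m).states E ω t
      = run n m E (extendCoins n m ω) t := by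
  intro t
  induction t with
  | zero => intro _; rfl
  | succ t ih =>
    intro ht
    have ih := ih (by omega)
    have hlt : t < (vertexCoverAlgorithm K n m).rounds := ht
    have hc : extendCoins n m ω t = ω ⟨t, hlt⟩ := funext fun i => dif_pos hlt
    funext i
    refine (dif_pos hlt).trans ?_
    rw [ih]
    have hrun : run n m E (extendCoins n m ω) (t + 1) i =
        { mem := (localStep n m t i (extendCoins n m ω t i)
            (run n m E (extendCoins n m ω) t i)).1
          inbox := fun j => (localStep n m t j (extendCoins n m ω t j)
            (run n m E (extendCoins n m ω) t j)).2 i } := rfl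
    rw [hrun, hc]
    rfl

theorem withinMemory_of_goodRun {G : SimpleGraph (Fin n)} [DecidableRel G.Adj] (hn : 3 ≤ n)
    (hmn : m / n + 1 ≤ n) {O : Finset (Fin n)} {E : (vertexCoverAlgorithm K n m).Placement}
    {ω : (vertexCoverAlgorithm K n m).Coins}
    (hE : (vertexCoverAlgorithm K n m).Distributes E G)
    (hlen : ∀ i, (E i).length ≤ K * (m / (vertexCoverAlgorithm K n m).machines + 1))
    (hgood : GoodRun n m G.Adj O (drawnLabels n m (extendCoins n m ω))) :
    (vertexCoverAlgorithm K n m).WithinMemory E ω := by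
  have hmem : (vertexCoverAlgorithm K n m).memory = 8 * (K * n) + 10 * n := by
    show (8 * K + 10) * n = _
    ring
  have hlen' : ∀ t i, (run n m E (extendCoins n m ω) t i).mem.length ≤ 2 * (K * n) :=
    length_mem_run_le hn hlen
  refine ⟨fun t ht i => ?_, fun t i => ?_, fun i => ?_⟩
  · rw [states_eq_run E ω t ht]
    refine ⟨?_, wordsBelow_run hn hmn t i⟩
    have h1 := hlen' t i
    have h2 : ∑ j, ((run n m E (extendCoins n m ω) t i).inbox j).length ≤ 8 * n :=
      sum_length_inbox_run_le hn hmn hE hgood ht i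
    rw [hmem]
    refine (add_le_add h1 h2).trans ?_
    omega
  · have hst := states_eq_run E ω t t.2.le
    have h3 : (vertexCoverAlgorithm K n m).action E ω t i
        = localStep n m t i (ω t i) (run n m E (extendCoins n m ω) t i) := by
      unfold Algorithm.action
      rw [hst]
      rfl
    rw [h3, hmem]
    have h1 := hlen' t i
    have h2 := sum_length_localStep_snd_le hmn t i (ω t i) (run n m E (extendCoins n m ω) t i)
    have h4 := length_localStep_fst (n := n) (m := m) t i (ω t i)
      (run n m E (extendCoins n m ω) t i)
    refine (add_le_add h4.le h2).trans ?_
    omega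
  · refine (card_le_univ _).trans ?_
    rw [Fintype.card_fin, hmem]
    omega

theorem isApproxVertexCover_of_goodRun {G : SimpleGraph (Fin n)} [DecidableRel G.Adj]
    {O : Finset (Fin n)} (hO : ∀ u v, G.Adj u v → u ∈ O ∨ v ∈ O)
    (hopt : O.card = G.vertexCoverNum.toNat) {E : (vertexCoverAlgorithm K n m).Placement}
    {ω : (vertexCoverAlgorithm K n m).Coins}
    (hE : (vertexCoverAlgorithm K n m).Distributes E G)
    (hgood : GoodRun n m G.Adj O (drawnLabels n m (extendCoins n m ω))) {α : ℝ}
    (hα : ((1 + 8 * (Nat.log 2 n + 1 + phases n) : ℕ) : ℝ) ≤ α) :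
    IsApproxVertexCover G α ((vertexCoverAlgorithm K n m).result E ω) := by
  set R := removed n m G.Adj (drawnLabels n m (extendCoins n m ω)) (phases n) with hR
  have hsplit : SplitsEdges (p := m / n + 1) E G.Adj := splitsEdges_of_sum_eq hE
  have hout : ∀ v, v ∈ (vertexCoverAlgorithm K n m).result E ω ↔
      ∃ i : Fin (m / n + 1), n + (v : ℕ) ∈ edgeWords R (E i) := by
    intro v
    unfold Algorithm.result
    rw [states_eq_run E ω (vertexCoverAlgorithm K n m).rounds le_rfl]
    simp only [mem_biUnion, mem_univ, true_and]
    refine exists_congr fun i => ?_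
    have hup := updatedMem_run (c := extendCoins n m ω) hsplit (phases n) i
    rw [← hR] at hup
    refine Iff.trans ?_ (iff_of_eq (congrArg (fun l => n + (v : ℕ) ∈ l) hup))
    exact mem_filter.trans (and_iff_right (mem_univ _))
  have hword : ∀ u v : Fin n, n + (v : ℕ) = vertexWord R u ↔ v = u ∧ u ∈ R := by
    intro u v
    unfold vertexWord
    split_ifs with h
    · simp [h, Fin.ext_iff]
    · have := u.2
      simp only [h, and_false, iff_false]
      omega
  constructor
  · intro u v huv
    have hdeg := card_nbrs_removed_lt (m := m) G.Adj (drawnLabels n m (extendCoins n m ω))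
      (phases n) u
    -- All degrees left at the end are below 2^0, so no edge avoids `R`.
    rw [degBits_phases, pow_zero, Nat.lt_one_iff, card_eq_zero] at hdeg
    have hUV : u ∈ R ∨ v ∈ R := by
      by_contra hcon
      rw [not_or] at hcon
      exact notMem_empty v (hdeg ▸ mem_nbrs.2 ⟨mem_univ _, huv, hcon.1, hcon.2⟩)
    obtain ⟨i, hi, -⟩ := (hsplit u v).2 huv
    -- The machine that stores an edge also holds the removal marks of its endpoints, and so outputs
    -- them.
    have hwords : ∀ x : Fin n, (x = u ∨ x = v) → x ∈ R → n + (x : ℕ) ∈ edgeWords R (E i) := by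
      intro x hx hxR
      unfold edgeWords
      rw [List.mem_flatMap]
      rcases hi with hi | hi
      · refine ⟨_, hi, ?_⟩
        simp only [List.mem_cons, List.not_mem_nil, or_false, hword]
        rcases hx with rfl | rfl
        · exact Or.inl ⟨rfl, hxR⟩
        · exact Or.inr ⟨rfl, hxR⟩
      · refine ⟨_, hi, ?_⟩
        simp only [List.mem_cons, List.not_mem_nil, or_false, hword]
        rcases hx with rfl | rfl
        · exact Or.inr ⟨rfl, hxR⟩
        · exact Or.inl ⟨rfl, hxR⟩
    rcases hUV with h | h
    · exact Or.inl (mem_coe.2 ((hout u).2 ⟨i, hwords u (Or.inl rfl) h⟩))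
    · exact Or.inr (mem_coe.2 ((hout v).2 ⟨i, hwords v (Or.inr rfl) h⟩))
  · have hsub : (vertexCoverAlgorithm K n m).result E ω ⊆ (R \ O) ∪ O := by
      intro v hv
      obtain ⟨i, hi⟩ := (hout v).1 hv
      obtain ⟨e, -, he⟩ := List.mem_flatMap.1 hi
      simp only [List.mem_cons, List.not_mem_nil, or_false, hword] at he
      have hvR : v ∈ R := by
        rcases he with ⟨rfl, h⟩ | ⟨rfl, h⟩ <;> exact h
      by_cases hvO : v ∈ O
      · exact mem_union_right _ hvO
      · exact mem_union_left _ (mem_sdiff.2 ⟨hvR, hvO⟩)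
    have h1 := card_removed_sdiff_le (n := n) (m := m) (fun u v h => h.symm) hO
      (fun r v => drawnLabels_lt (c := extendCoins n m ω) r v) (phases n) hgood
    have h2 := sum_levels_add_degBits_le n m (phases n)
    have h3 : ((vertexCoverAlgorithm K n m).result E ω).card
        ≤ (1 + 8 * (Nat.log 2 n + 1 + phases n)) * O.card := by
      calc _ ≤ (R \ O).card + O.card := (card_le_card hsub).trans (card_union_le _ _)
        _ ≤ 8 * (Nat.log 2 n + 1 + phases n) * O.card + O.card := by
          refine Nat.add_le_add_right (h1.trans (Nat.mul_le_mul_right _ ?_)) _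
          omega
        _ = _ := by ring
    rw [← hopt]
    calc (((vertexCoverAlgorithm K n m).result E ω).card : ℝ)
        ≤ ((1 + 8 * (Nat.log 2 n + 1 + phases n) : ℕ) : ℝ) * O.card := by exact_mod_cast h3
      _ ≤ α * O.card := by gcongr

end Analysis

/-! ### Failure probability over the coins. -/

section Probability

open Finset Classical

variable {n m : ℕ}

/-- The labels of a phase are independent and uniformly distributed. -/
theorem frac_coinLabel (r : ℕ) (P : (Fin n → ℕ) → Prop) :
    frac (fun x : Fin (m / n + 1) → Fin (n * maxBits n m) → Bool =>
      P fun v => coinLabel n m r (x (Fin.ofNat _ v)) v)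
    = frac fun f : Fin n → Fin (maxBits n m) → Bool =>
      P fun v => bitLabel (maxBits n m) (bits n m r) (f v) := by
  let e : Fin n × Fin (maxBits n m) → Fin (m / n + 1) × Fin (n * maxBits n m) :=
    fun q => (Fin.ofNat _ q.1, finProdFinEquiv q)
  -- The pair (v, b) is recovered from the coin index alone, so distinct vertices use distinct
  -- coins.
  have he : Function.Injective e := fun q q' h => finProdFinEquiv.injective (Prod.ext_iff.1 h).2
  rw [← frac_equiv (Equiv.curry (Fin (m / n + 1)) (Fin (n * maxBits n m)) Bool),
    ← frac_equiv (Equiv.curry (Fin n) (Fin (maxBits n m)) Bool)]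
  exact frac_comp_injective e he fun y : Fin n × Fin (maxBits n m) → Bool =>
    P fun v => bitLabel (maxBits n m) (bits n m r) fun b => y (v, b)

theorem removed_congr {G : Fin n → Fin n → Prop} {g g' : ℕ → Fin n → ℕ} :
    ∀ {r}, (∀ i < r, g i = g' i) → removed n m G g r = removed n m G g' r
  | 0, _ => rfl
  | r + 1, h => by
    have ih : removed n m G g r = removed n m G g' r := removed_congr fun i hi => h i (by omega)
    rw [removed_succ, removed_succ, halfRemoved, halfRemoved, ih, h r (by omega)]

/-- All coins except those of round 6r are frozen. The graph entering phase r depends only on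
earlier labels, so it is fixed while the labels of phase r are uniform. -/
theorem frac_not_goodLabels_drawn_le {G : SimpleGraph (Fin n)} [DecidableRel G.Adj]
    (hm : G.edgeFinset.card = m) (O : Finset (Fin n)) (hn : 3 ≤ n) (hmn : m / n + 1 ≤ n) {r : ℕ}
    (hr : r < phases n) :
    frac (fun ω : Fin (6 * phases n) → Fin (m / n + 1) → Fin (n * maxBits n m) → Bool =>
      ¬ GoodLabels n m r
        (alive G.Adj (removed n m G.Adj (drawnLabels n m (extendCoins n m ω)) r)) O
        (drawnLabels n m (extendCoins n m ω) r))
      ≤ 1 / (n : ℝ) ^ 2 + if r = 0 then 2 / (n : ℝ) else 0 := by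
  have ht : 6 * r < 6 * phases n := by omega
  refine frac_le_of_resample _ (⟨6 * r, ht⟩ : Fin (6 * phases n)) ?_ fun ω => ?_
  · split_ifs <;> positivity
  set R := removed n m G.Adj (drawnLabels n m (extendCoins n m ω)) r with hR
  have h1 : ∀ x, removed n m G.Adj (drawnLabels n m
      (extendCoins n m (Function.update ω ⟨6 * r, ht⟩ x))) r = R := by
    intro x
    refine removed_congr fun i hi => ?_
    have hne : ∀ h, (⟨6 * i, h⟩ : Fin (6 * phases n)) ≠ ⟨6 * r, ht⟩ := by
      intro h h'
      have := Fin.mk.inj_iff.1 h'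
      omega
    funext v
    unfold drawnLabels extendCoins
    split_ifs with h
    · rw [Function.update_of_ne (hne h)]
    · rfl
  have h2 : ∀ x, drawnLabels n m (extendCoins n m (Function.update ω ⟨6 * r, ht⟩ x)) r
      = fun v : Fin n => coinLabel n m r (x (Fin.ofNat _ v)) v := by
    intro x
    funext v
    unfold drawnLabels extendCoins
    rw [dif_pos ht, Function.update_self]
  simp only [h1, h2]
  rw [frac_coinLabel r fun g => ¬ GoodLabels n m r (alive G.Adj R) O g]
  refine frac_not_goodLabels_le (bits_le_maxBits n m r) hn hmn
    (card_nbrs_removed_lt G.Adj _ r) (s := G.edgeFinset) (fun e he => ?_) hm.le fun u v h => ?_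
  · exact G.not_isDiag_of_mem_edgeFinset he
  · simpa using h.1

/-- Only phase 0 pays the Chebyshev term 2/n; the Chernoff term 1/n² is summed over all phases. -/
theorem frac_not_goodRun_le {G : SimpleGraph (Fin n)} [DecidableRel G.Adj]
    (hm : G.edgeFinset.card = m) (O : Finset (Fin n)) (hn : 3 ≤ n) (hmn : m / n + 1 ≤ n) :
    frac (fun ω : Fin (6 * phases n) → Fin (m / n + 1) → Fin (n * maxBits n m) → Bool =>
      ¬ GoodRun n m G.Adj O (drawnLabels n m (extendCoins n m ω)))
      ≤ phases n * (1 / (n : ℝ) ^ 2) + 2 / n := by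
  set bad : ℕ → (Fin (6 * phases n) → Fin (m / n + 1) → Fin (n * maxBits n m) → Bool) → Prop :=
    fun r ω => ¬ GoodLabels n m r
        (alive G.Adj (removed n m G.Adj (drawnLabels n m (extendCoins n m ω)) r)) O
        (drawnLabels n m (extendCoins n m ω) r) with hbad
  have h0 : 0 < phases n := by unfold phases; omega
  have hb := fun {r} (hr : r < phases n) => frac_not_goodLabels_drawn_le hm O hn hmn hr
  have key : ∀ ω, ¬ GoodRun n m G.Adj O (drawnLabels n m (extendCoins n m ω)) →
      bad 0 ω ∨ ∃ r ∈ (range (phases n)).erase 0, bad r ω := by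
    intro ω h
    unfold GoodRun at h
    push Not at h
    obtain ⟨r, hr, h⟩ := h
    by_cases hr0 : r = 0
    · subst hr0
      exact Or.inl h
    · exact Or.inr ⟨r, mem_erase.2 ⟨hr0, mem_range.2 hr⟩, h⟩
  have h1 : frac (bad 0) ≤ 1 / (n : ℝ) ^ 2 + 2 / n := by simpa using hb h0
  have h2 : frac (fun ω => ∃ r ∈ (range (phases n)).erase 0, bad r ω)
      ≤ ((range (phases n)).erase 0).card * (1 / (n : ℝ) ^ 2) := by
    refine frac_exists_le _ _ fun r hr => ?_
    obtain ⟨hr0, hr⟩ := mem_erase.1 hr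
    have := hb (mem_range.1 hr)
    rwa [if_neg hr0, add_zero] at this
  have h3 : (((range (phases n)).erase 0).card : ℝ) = phases n - 1 := by
    rw [card_erase_of_mem (mem_range.2 h0), card_range, Nat.cast_sub h0, Nat.cast_one]
  rw [h3] at h2
  have := (frac_mono key).trans (frac_or_le _ _)
  linarith

theorem prob_eq_frac {n : ℕ} (A : Algorithm n) (S : A.Coins → Prop) : A.prob S = frac S := rfl

/-- A simple graph needs at most n machines here; hence a broadcast of one short block per machine
fits into 2n words. -/
theorem div_add_one_le_of_card_edgeFinset_eq {G : SimpleGraph (Fin n)} [DecidableRel G.Adj]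
    (hm : G.edgeFinset.card = m) (hn : 3 ≤ n) : m / n + 1 ≤ n := by
  have h1 := G.card_edgeFinset_le_card_choose_two
  rw [hm, Fintype.card_fin, Nat.choose_two_right] at h1
  have h2 : m ≤ n * (n - 1) := h1.trans (Nat.div_le_self _ _)
  have h3 : m / n ≤ n - 1 := Nat.div_le_of_le_mul h2
  omega

theorem one_le_log {n : ℕ} (hn : 3 ≤ n) : 1 ≤ Real.log n := by
  have h3 : (3 : ℝ) ≤ n := by exact_mod_cast hn
  rw [Real.le_log_iff_exp_le (by linarith)]
  linarith [Real.exp_one_lt_d9]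

theorem natLog_le_two_mul_log {k : ℕ} (hk : k ≠ 0) : (Nat.log 2 k : ℝ) ≤ 2 * Real.log k := by
  have h1 : ((2 : ℝ) ^ Nat.log 2 k) ≤ k := by exact_mod_cast Nat.pow_log_le_self 2 hk
  have h2 := Real.log_le_log (by positivity) h1
  rw [Real.log_pow] at h2
  have := Real.log_two_gt_d9
  have h3 : (0 : ℝ) ≤ Nat.log 2 k := Nat.cast_nonneg _
  nlinarith

theorem loglog_le {n : ℕ} (hn : 3 ≤ n) : (loglog n : ℝ) ≤ 2 + 2 * Real.log (Real.log n) := by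
  have h0 : 0 < Nat.log 2 n := Nat.log_pos (by norm_num) (by omega)
  have h1 := natLog_le_two_mul_log (k := Nat.log 2 n) h0.ne'
  have h2 := natLog_le_two_mul_log (k := n) (by omega)
  have h3 := one_le_log hn
  have h4 : Real.log (Nat.log 2 n) ≤ Real.log (2 * Real.log n) :=
    Real.log_le_log (by exact_mod_cast h0) h2
  rw [Real.log_mul (by norm_num) (by linarith)] at h4
  have := Real.log_two_lt_d9
  unfold loglog
  linarith

end Probability

end MPC

/-! ### Choice of the constant. -/

open MPC

theorem theorem1 :
    ∀ K : ℕ, ∃ C : ℝ, ∃ A : (n m : ℕ) → MPC.Algorithm n,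
      ∀ n m : ℕ, 3 ≤ n →
        ((A n m).memory : ℝ) ≤ C * n ∧
        ((A n m).machines : ℝ) * ((A n m).memory : ℝ) ≤ C * ((n : ℝ) + (m : ℝ)) ∧
        ((A n m).wordBits : ℝ) ≤ C * Real.log n ∧
        ((A n m).rounds : ℝ) ≤ C * Real.log (Real.log n) ∧
        ∀ (G : SimpleGraph (Fin n)) [DecidableRel G.Adj], G.edgeFinset.card = m →
          ∀ E : (A n m).Placement, (A n m).Distributes E G →
            (∀ i, (E i).length ≤ K * (m / (A n m).machines + 1)) →
              1 - C / n ≤ (A n m).prob fun ω =>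
                (A n m).WithinMemory E ω ∧
                  MPC.IsApproxVertexCover G (C * Real.log n) ((A n m).result E ω) := by
  classical
  intro K
  -- The smallest value of log log n for n ≥ 3; it is positive, so additive constants in the round
  -- bound can be absorbed.
  set b : ℝ := Real.log (Real.log 3) with hb
  have hlog3 : 1 < Real.log 3 := by
    rw [Real.lt_log_iff_exp_lt (by norm_num)]
    linarith [Real.exp_one_lt_d9]
  have hb0 : 0 < b := Real.log_pos hlog3
  -- The first summand pays for memory. The rounds are at most 36 log log n + 150, whence 150/b. The
  -- number 257 exceeds 64 + 161, needed for the ratio 32 log₂ n + 161, and 12, needed for the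
  -- failure probability.
  refine ⟨(8 * K + 10 : ℕ) + 257 + 150 / b, vertexCoverAlgorithm K, fun n m hn => ?_⟩
  set C : ℝ := (8 * K + 10 : ℕ) + 257 + 150 / b with hC
  have hbC : 0 ≤ 150 / b := by positivity
  have hK0 : (0 : ℝ) ≤ (8 * K + 10 : ℕ) := Nat.cast_nonneg _
  have hn3 : (3 : ℝ) ≤ n := by exact_mod_cast hn
  have hn0 : (0 : ℝ) < n := by linarith
  have hlogn := one_le_log hn
  have hlam := natLog_le_two_mul_log (k := n) (by omega)
  have hell := loglog_le hn
  have hloglog : b ≤ Real.log (Real.log n) :=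
    Real.log_le_log (by linarith) (Real.log_le_log (by norm_num) hn3)
  have hphases : phases n ≤ 3 * Nat.log 2 n + 19 := by
    have : loglog n ≤ Nat.log 2 n := Nat.log_le_self _ _
    unfold phases
    omega
  refine ⟨?_, ?_, ?_, ?_, ?_⟩
  · show (((8 * K + 10) * n : ℕ) : ℝ) ≤ C * n
    rw [Nat.cast_mul]
    gcongr
    linarith
  · show ((m / n + 1 : ℕ) : ℝ) * (((8 * K + 10) * n : ℕ) : ℝ) ≤ C * (n + m)
    have h1 : ((m / n + 1 : ℕ) : ℝ) * n ≤ n + m := by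
      have : (m / n + 1) * n ≤ n + m := by
        have := Nat.div_mul_le_self m n
        nlinarith
      exact_mod_cast this
    calc _ = ((8 * K + 10 : ℕ) : ℝ) * (((m / n + 1 : ℕ) : ℝ) * n) := by push_cast; ring
      _ ≤ C * (n + m) := by
        gcongr
        linarith
  · show ((Nat.log 2 n + 4 : ℕ) : ℝ) ≤ C * Real.log n
    push_cast
    nlinarith
  · show ((6 * phases n : ℕ) : ℝ) ≤ C * Real.log (Real.log n)
    have h1 : (150 : ℝ) ≤ 150 / b * Real.log (Real.log n) := by
      rw [div_mul_eq_mul_div, le_div_iff₀ hb0]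
      nlinarith
    have h2 : ((6 * phases n : ℕ) : ℝ) = 18 * loglog n + 114 := by
      unfold phases
      push_cast
      ring
    rw [h2, hC]
    nlinarith
  · intro G _ hm E hE hlen
    have hmn := div_add_one_le_of_card_edgeFinset_eq hm hn
    obtain ⟨s, hs, hcover⟩ := G.vertexCoverNum_exists
    have hcard : s.toFinset.card = G.vertexCoverNum.toNat := by
      rw [← hs, Set.encard_eq_coe_toFinset_card, ENat.toNat_natCast]
    have hO : ∀ u v, G.Adj u v → u ∈ s.toFinset ∨ v ∈ s.toFinset := by
      intro u v h
      simpa using hcover h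
    have hα : ((1 + 8 * (Nat.log 2 n + 1 + phases n) : ℕ) : ℝ) ≤ C * Real.log n := by
      have h1 : ((1 + 8 * (Nat.log 2 n + 1 + phases n) : ℕ) : ℝ) ≤ 32 * Nat.log 2 n + 161 := by
        have : 1 + 8 * (Nat.log 2 n + 1 + phases n) ≤ 32 * Nat.log 2 n + 161 := by omega
        exact_mod_cast this
      nlinarith
    have hbad := frac_not_goodRun_le hm s.toFinset hn hmn
    rw [prob_eq_frac]
    refine le_trans ?_ (frac_mono (P := fun ω => GoodRun n m G.Adj s.toFinset
      (drawnLabels n m (extendCoins n m ω))) fun ω hgood =>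
        ⟨withinMemory_of_goodRun hn hmn hE hlen hgood,
          isApproxVertexCover_of_goodRun hO hcard hE hgood hα⟩)
    refine le_trans ?_ (one_sub_frac_not_le _)
    refine sub_le_sub_left (le_trans hbad ?_) 1
    have h1 : (phases n : ℝ) ≤ 10 * n := by
      have : Nat.log 2 n < n := Nat.log_lt_self 2 (by omega)
      have : phases n ≤ 10 * n := by omega
      exact_mod_cast this
    calc (phases n : ℝ) * (1 / (n : ℝ) ^ 2) + 2 / n ≤ 10 * n * (1 / (n : ℝ) ^ 2) + 2 / n := by gcongr
      _ = 12 / (n : ℝ) := by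
        field_simp
        norm_num
      _ ≤ C / n := by
        gcongr
        linarith
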